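/- Let $\mathbb K$ be a field of characteristic $2$. All superspaces are $\mathbb Z/2$-graded $\mathbb K$-vector spaces $V=V_{\bar 0}\oplus V_{\bar 1}$, and an associative superalgebra is a $\mathbb Z/2$-graded associative $\mathbb K$-algebra, not necessarily unital; morphisms of associative superalgebras are not required to preserve units. A Lie superalgebra $(L,[-,-],s)$ is a superspace such that $L_{\bar 0}$ is a Lie algebra, $L_{\bar 1}$ is an $L_{\bar 0}$-module made two-sided by symmetry, and $s:L_{\bar 1}\to L_{\bar 0}$ satisfies $s(\lambda x)=\lambda^2 s(x)$, $[x,y]=s(x+y)-s(x)-s(y)$ for $x,y\in L_{\bar 1}$ (with bilinear bracket), and $[s(x),y]=[x,[x,y]]$ for $x\in L_{\bar 1}$, $y\in L$. An associative superalgebra $B$ is a Lie superalgebra with the commutator and $s(b)=b^2$. A morphism of Lie superalgebras is an even linear map $\varphi$ with $\varphi([x,y])=[\varphi(x),\varphi(y)]$ for $x$ even and $y$ arbitrary, and $\varphi(s(x))=s(\varphi(x))$ for $x$ odd. Let $(P,\{-,-\},s)$ be a unital Poisson superalgebra: a Lie superalgebra with a unital associative product (compatible with the grading) such that $xy=yx$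 for all $x,y$, $x^2=0$ for $x$ odd, $\{xy,z\}=x\{y,z\}+\{x,z\}y$ for all $x,y,z$, and $s(xy)=x^2s(y)+xy\{x,y\}$ for $x\in P_{\bar 0}$, $y\in P_{\bar 1}$. Let $\Omega_P$ be the $P$-module of Kähler differentials of $P$ over $\mathbb K$, with universal derivation $\mathrm d$ and grading $|x\,\mathrm dy|=|x|+|y|$. It is a Lie superalgebra with the bracket $$[x\,\mathrm dy,z\,\mathrm dw]=xz\,\mathrm d\{y,w\}+x\{y,z\}\,\mathrm dw+z\{w,x\}\,\mathrm dy$$ and the squaring $\tilde s$ with $\tilde s(\omega+\eta)=\tilde s(\omega)+\tilde s(\eta)+[\omega,\eta]$ for odd $\omega,\eta$, $\tilde s(x\,\mathrm dy)=x^2\,\mathrm d s(y)+x\{x,y\}\,\mathrm dy$ for $x\in P_{\bar 0}$, $y\in P_{\bar 1}$, and $\tilde s(x\,\mathrm dy)=x\{x,y\}\,\mathrm dy$ for $x\in P_{\bar 1}$, $y\in P_{\bar 0}$; with the anchor $\rho(x\,\mathrm dy)=x\{y,-\}$ this makes $(P,\Omega_P,\rho)$ a Lie–Rinehart superalgebra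 in characteristic $2$. The superspace $P\oplus\Omega_P$ is a Lie superalgebra with $[a+\omega,b+\eta]=\rho_\omega(b)+\rho_\eta(a)+[\omega,\eta]$ and $s(a+\omega)=\rho_\omega(a)+\tilde s(\omega)$. Let $U(P\oplus\Omega_P)$ be its enveloping algebra, that is, the tensor algebra modulo the two-sided ideal generated by the elements $u\otimes v+v\otimes u+[u,v]$ and, for $u$ odd, $u\otimes u+s(u)$; let $i$ be the canonical map of $P\oplus\Omega_P$ into it, and let $\overline U(P\oplus\Omega_P)$ be the (non-unital) subalgebra generated by the image of $i$. Put $$U(P,\Omega_P)=\overline U(P\oplus\Omega_P)/J,$$ where $J$ is the two-sided ideal generated by the elements $i(a)\,i(b+\omega)+i(ab+a\omega)$ with $a,b\in P$, $\omega\in\Omega_P$. Give $U(P,\Omega_P)$ the grading induced from $P\oplus\Omega_P$, and let $i_P:P\to U(P,\Omega_P)$ and $i_\Omega:\Omega_P\to U(P,\Omega_P)$ be the canonical maps. For an associative superalgebra $B$, an even morphism of associative superalgebras $m:P\to B$ and an even morphism of Lie superalgebras $h:P\to B$, consider the conditions \begin{align*} h(xy)&=m(x)h(y)+m(y)h(x),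 && x,y\in P,\tag{UEA1}\\ m(\{x,y\})&=m(x)h(y)+h(y)m(x), && x,y\in P,\tag{UEA2}\\ m(y)h(x)m(x)&=m(x)m(y)h(x), && x\in P_{\bar 1},\ y\in P_{\bar 0},\tag{UEA3}\\ m(y)^2h(x)&=m(y)h(x)m(y)+m(x)m(y)h(y)+h(y)m(x)m(y), && x\in P_{\bar 1},\ y\in P_{\bar 0}.\tag{UEA4} \end{align*} **Theorem.** $U(P,\Omega_P)$ is an associative superalgebra, and the triple $(U(P,\Omega_P),\,i_P,\,i_\Omega\circ\mathrm d)$ is a universal enveloping algebra of the Poisson superalgebra $P$: $i_P$ is an even morphism of associative superalgebras, $i_\Omega\circ\mathrm d$ is an even morphism of Lie superalgebras, they satisfy (UEA1)–(UEA4), and for every triple $(B,m',h')$ of an associative superalgebra $B$, an even morphism of associative superalgebras $m':P\to B$ and an even morphism of Lie superalgebras $h':P\to B$ satisfying (UEA1)–(UEA4) there is a unique even morphism of associative superalgebras $f:U(P,\Omega_P)\to B$ with $f\circ i_\Omega\circ\mathrm d=h'$ and $f\circ i_P=m'$. Moreover, $i_P(1)$ is a two-sided identity of $U(P,\Omega_P)$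 (so that $f$ preserves identities whenever $B$ is unital and $m'(1)=1$). -/

import Mathlib

open scoped KaehlerDifferential

set_option linter.unusedSectionVars false

universe w u v

/-- A Lie superalgebra over a field `K` of characteristic `2` on a vector space `L` graded by
`ℒ 0` (even part) and `ℒ 1` (odd part): the even part is a Lie algebra, the odd part is a module
over it, made two-sided by symmetry, and there is a squaring `s` from the odd to the even part,
whose polarization is the bracket of odd elements and which satisfies the Jacobi identity
`[s(x), y] = [x, [x, y]]`. -/
structure LieSuperalgebra (K L : Type*) [Field K] [AddCommGroup L] [Module K L]
    (ℒ : ZMod 2 → Submodule K L) where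
  isInternal : DirectSum.IsInternal ℒ
  bracket : L →ₗ[K] L →ₗ[K] L
  /-- The squaring. -/
  sq : ℒ 1 → ℒ 0
  bracket_mem : ∀ (i j : ZMod 2), ∀ x ∈ ℒ i, ∀ y ∈ ℒ j, bracket x y ∈ ℒ (i + j)
  bracket_self : ∀ x ∈ ℒ 0, bracket x x = 0
  /-- For even `z` this is the Jacobi identity of the Lie algebra `ℒ 0`, for odd `z` it says that
  `ℒ 1` is a module over it. -/
  jacobi : ∀ x ∈ ℒ 0, ∀ y ∈ ℒ 0, ∀ z : L,
    bracket (bracket x y) z = bracket x (bracket y z) - bracket y (bracket x z)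
  bracket_comm : ∀ x ∈ ℒ 0, ∀ y ∈ ℒ 1, bracket y x = bracket x y
  sq_smul : ∀ (c : K) (x : ℒ 1), sq (c • x) = c ^ 2 • sq x
  bracket_odd : ∀ x y : ℒ 1, bracket x y = sq (x + y) - sq x - sq y
  bracket_sq : ∀ (x : ℒ 1) (y : L), bracket (sq x) y = bracket x (bracket x y)

/-- A unital Poisson superalgebra in characteristic `2`: a Lie superalgebra whose underlying graded
space is an associative supercommutative algebra (commutative, with `x² = 0` for odd `x`), such
that `{xy, z} = x{y, z} + {x, z}y`, and `s(xy) = x² s(y) + xy{x, y}` for even `x` and odd `y`. -/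
structure PoissonSuperalgebra (K P : Type*) [Field K] [CommRing P] [Algebra K P]
    (𝒜 : ZMod 2 → Submodule K P) [GradedAlgebra 𝒜] extends LieSuperalgebra K P 𝒜 where
  odd_mul_self : ∀ x ∈ 𝒜 1, x * x = 0
  leibniz : ∀ x y z : P, bracket (x * y) z = x * bracket y z + bracket x z * y
  sq_mul : ∀ x ∈ 𝒜 0, ∀ y xy : 𝒜 1, (xy : P) = x * y →
    (sq xy : P) = x ^ 2 * sq y + x * y * bracket x y

/-- A Lie-Rinehart superalgebra `(A, L, ρ)` in characteristic `2`, with `A` unital: `A` is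
associative and supercommutative, `L` is a Lie superalgebra and a graded `A`-module, and the anchor
`ρ : L → Der(A)` is an even `A`-linear morphism of Lie superalgebras, where `Der(A)` carries the
commutator and the squaring `D ↦ D²`, such that the three compatibility conditions
`bracket_smul`, `sq_smul_even` and `sq_smul_odd` hold. -/
structure LieRinehartSuperalgebra (K A L : Type*) [Field K] [CommRing A] [Algebra K A]
    (𝒜 : ZMod 2 → Submodule K A) [GradedAlgebra 𝒜] [AddCommGroup L] [Module K L] [Module A L]
    [IsScalarTower K A L] (ℒ : ZMod 2 → Submodule K L) extends LieSuperalgebra K L ℒ where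
  odd_mul_self : ∀ a ∈ 𝒜 1, a * a = 0
  smul_mem : ∀ (i j : ZMod 2), ∀ a ∈ 𝒜 i, ∀ x ∈ ℒ j, a • x ∈ ℒ (i + j)
  /-- The anchor `ρ`. -/
  anchor : L →ₗ[A] Derivation K A A
  anchor_mem : ∀ (i j : ZMod 2), ∀ x ∈ ℒ i, ∀ a ∈ 𝒜 j, anchor x a ∈ 𝒜 (i + j)
  anchor_bracket : ∀ x ∈ ℒ 0, ∀ y : L, anchor (bracket x y) = ⁅anchor x, anchor y⁆
  anchor_sq : ∀ (x : ℒ 1) (a : A), anchor (sq x) a = anchor x (anchor x a)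
  bracket_smul : ∀ (a : A) (x y : L), bracket x (a • y) = a • bracket x y + anchor x a • y
  sq_smul_even : ∀ a ∈ 𝒜 0, ∀ x ax : ℒ 1, (ax : L) = a • (x : L) →
    (sq ax : L) = a ^ 2 • (sq x : L) + anchor (a • (x : L)) a • (x : L)
  sq_smul_odd : ∀ a ∈ 𝒜 1, ∀ (x : ℒ 0) (ax : ℒ 1), (ax : L) = a • (x : L) →
    (sq ax : L) = anchor (a • (x : L)) a • (x : L)

/-- Associative (not necessarily unital) superalgebras. -/
structure IsAssocSuperalgebra {K B : Type*} [Field K] [NonUnitalRing B] [Module K B]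
    (ℬ : ZMod 2 → Submodule K B) : Prop where
  isInternal : DirectSum.IsInternal ℬ
  mul_mem : ∀ (i j : ZMod 2), ∀ a ∈ ℬ i, ∀ b ∈ ℬ j, a * b ∈ ℬ (i + j)

namespace PoissonSuperalgebra
variable {K P : Type*} [Field K] [CommRing P] [Algebra K P]
  {𝒜 : ZMod 2 → Submodule K P} [GradedAlgebra 𝒜] (S : PoissonSuperalgebra K P 𝒜)

/-- Triples `(B, m, h)` of an associative superalgebra `B`, an even morphism of associative algebras
`m : P → B` and an even morphism of Lie superalgebras `h : P → B`, for the commutator and the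
squaring `b ↦ b²` on `B`, that satisfy the four compatibility conditions. -/
structure IsEnvelopingTriple {B : Type*} [NonUnitalRing B] [Module K B]
    (ℬ : ZMod 2 → Submodule K B) (m : P →ₙₐ[K] B) (h : P →ₗ[K] B) : Prop where
  superalgebra : IsAssocSuperalgebra ℬ
  m_mem : ∀ (i : ZMod 2), ∀ x ∈ 𝒜 i, m x ∈ ℬ i
  h_mem : ∀ (i : ZMod 2), ∀ x ∈ 𝒜 i, h x ∈ ℬ i
  h_bracket : ∀ x ∈ 𝒜 0, ∀ y : P, h (S.bracket x y) = h x * h y - h y * h x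
  h_sq : ∀ x : 𝒜 1, h (S.sq x) = h x * h x
  uea1 : ∀ x y : P, h (x * y) = m x * h y + m y * h x
  uea2 : ∀ x y : P, m (S.bracket x y) = m x * h y + h y * m x
  uea3 : ∀ x ∈ 𝒜 1, ∀ y ∈ 𝒜 0, m y * h x * m x = m x * m y * h x
  uea4 : ∀ x ∈ 𝒜 1, ∀ y ∈ 𝒜 0,
    m y * m y * h x = m y * h x * m y + m x * m y * h y + h y * m x * m y

/-- The triple `(U, m, h)` is a universal enveloping algebra of the Poisson superalgebra: it is one
of the triples above, and every such triple `(B, m', h')` arises from it through a unique even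
morphism of associative algebras `f : U → B` with `f ∘ h = h'` and `f ∘ m = m'`. Algebras and their
morphisms are not required to be unital. -/
structure IsUniversalEnveloping.{w', u', v', x'} {K : Type u'} {P : Type v'} [Field K] [CommRing P]
    [Algebra K P] {𝒜 : ZMod 2 → Submodule K P} [GradedAlgebra 𝒜]
    (S : PoissonSuperalgebra K P 𝒜) {U : Type x'} [NonUnitalRing U] [Module K U]
    (𝒰 : ZMod 2 → Submodule K U) (m : P →ₙₐ[K] U) (h : P →ₗ[K] U) : Prop where
  triple : S.IsEnvelopingTriple 𝒰 m h
  existsUnique : ∀ (B : Type w') [NonUnitalRing B] [Module K B] [IsScalarTower K B B]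
    [SMulCommClass K B B] (ℬ : ZMod 2 → Submodule K B) (m' : P →ₙₐ[K] B) (h' : P →ₗ[K] B),
    S.IsEnvelopingTriple ℬ m' h' → ∃! f : U →ₙₐ[K] B,
      (∀ (i : ZMod 2), ∀ u ∈ 𝒰 i, f u ∈ ℬ i) ∧ (∀ x, f (h x) = h' x) ∧ ∀ x, f (m x) = m' x

end PoissonSuperalgebra

theorem parity_cases (i : ZMod 2) : i = 0 ∨ i = 1 := by
  revert i; decide

theorem add_self_eq_zero_of_charTwo (K : Type*) {M : Type*} [Field K] [CharP K 2]
    [AddCommGroup M] [Module K M] (x : M) : x + x = 0 := by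
  rw [← two_smul K x, CharTwo.two_eq_zero, zero_smul]

theorem neg_eq_of_charTwo (K : Type*) {M : Type*} [Field K] [CharP K 2]
    [AddCommGroup M] [Module K M] (x : M) : -x = x :=
  neg_eq_of_add_eq_zero_left (add_self_eq_zero_of_charTwo K x)

theorem sub_eq_add_of_charTwo (K : Type*) {M : Type*} [Field K] [CharP K 2]
    [AddCommGroup M] [Module K M] (x y : M) : x - y = x + y := by
  rw [sub_eq_add_neg, neg_eq_of_charTwo K]

theorem isInternal_iff_isCompl {K M : Type*} [Field K] [AddCommGroup M] [Module K M]
    (ℒ : ZMod 2 → Submodule K M) : DirectSum.IsInternal ℒ ↔ IsCompl (ℒ 0) (ℒ 1) :=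
  DirectSum.isInternal_submodule_iff_isCompl ℒ (by decide)
    (by ext i; simpa using parity_cases i)

namespace LieSuperalgebra

theorem exists_parts {K L : Type*} [Field K] [AddCommGroup L] [Module K L]
    {ℒ : ZMod 2 → Submodule K L} (S : LieSuperalgebra K L ℒ) (x : L) :
    ∃ a : ℒ 0, ∃ b : ℒ 1, x = a + b := by
  have h := ((isInternal_iff_isCompl ℒ).1 S.isInternal).sup_eq_top
  have hx : x ∈ ℒ 0 ⊔ ℒ 1 := by rw [h]; trivial
  obtain ⟨a, ha, b, hb, e⟩ := Submodule.mem_sup.1 hx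
  exact ⟨⟨a, ha⟩, ⟨b, hb⟩, e.symm⟩

theorem bracket_mem_of_eq {K L : Type*} [Field K] [AddCommGroup L] [Module K L]
    {ℒ : ZMod 2 → Submodule K L} (S : LieSuperalgebra K L ℒ)
    {i j k : ZMod 2} (h : i + j = k) {x y : L} (hx : x ∈ ℒ i) (hy : y ∈ ℒ j) :
    S.bracket x y ∈ ℒ k := h ▸ S.bracket_mem i j x hx y hy

variable {K L : Type*} [Field K] [CharP K 2] [AddCommGroup L] [Module K L]
    {ℒ : ZMod 2 → Submodule K L} (S : LieSuperalgebra K L ℒ)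

theorem alt_odd (y : ℒ 1) : S.bracket y y = 0 := by
  have h : y + y = 0 := add_self_eq_zero_of_charTwo K y
  have h0 : S.sq 0 = 0 := by simpa using S.sq_smul 0 0
  have := S.bracket_odd y y
  rw [h, h0] at this
  rw [this]
  have h2 := add_self_eq_zero_of_charTwo K ((S.sq y : ℒ 0) : L)
  simp only [ZeroMemClass.coe_zero, zero_sub]
  rw [← neg_add', h2, neg_zero]

theorem alt (x : L) : S.bracket x x = 0 := by
  obtain ⟨a, b, rfl⟩ := S.exists_parts x
  simp only [map_add, LinearMap.add_apply]
  rw [S.bracket_self _ a.2, S.alt_odd, S.bracket_comm _ a.2 _ b.2, zero_add, add_zero]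
  exact add_self_eq_zero_of_charTwo K _

theorem comm (x y : L) : S.bracket x y = S.bracket y x := by
  have h := S.alt (x + y)
  simp only [map_add, LinearMap.add_apply, S.alt, zero_add, add_zero] at h
  rw [← sub_eq_zero, sub_eq_add_of_charTwo K, add_comm]
  exact h

theorem jacobi_odd (x y : ℒ 1) (z : L) : S.bracket (S.bracket x y) z =
    S.bracket x (S.bracket y z) + S.bracket y (S.bracket x z) := by
  rw [S.bracket_odd]
  simp only [map_sub, LinearMap.sub_apply, S.bracket_sq, Submodule.coe_add, map_add,
    LinearMap.add_apply]
  abel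

theorem jacobi_all (x y z : L) : S.bracket (S.bracket x y) z =
    S.bracket x (S.bracket y z) + S.bracket y (S.bracket x z) := by
  have hee : ∀ (x y : ℒ 0) (z : L), S.bracket (S.bracket x y) z =
      S.bracket x (S.bracket y z) + S.bracket y (S.bracket x z) := fun x y z => by
    rw [S.jacobi x x.2 y y.2 z, sub_eq_add_of_charTwo K]
  have heo : ∀ (x : ℒ 0) (y : ℒ 1) (z : L), S.bracket (S.bracket x y) z =
      S.bracket x (S.bracket y z) + S.bracket y (S.bracket x z) := fun x y z => by
    obtain ⟨a, b, rfl⟩ := S.exists_parts z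
    have h1 := hee x a y
    have h2 := S.jacobi_odd y b x
    rw [S.comm (S.bracket x a), S.comm a] at h1
    rw [S.comm (S.bracket y b), S.comm b, S.comm y x, S.comm b] at h2
    have h3 := add_self_eq_zero_of_charTwo K (S.bracket (x : L) (S.bracket (y : L) a))
    have h4 := add_self_eq_zero_of_charTwo K (S.bracket (y : L) (S.bracket (x : L) b))
    have h5 := S.comm a (S.bracket x y)
    have h6 := S.comm b (S.bracket x y)
    simp only [map_add]
    grind
  obtain ⟨a, b, rfl⟩ := S.exists_parts x
  obtain ⟨c, d, rfl⟩ := S.exists_parts y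
  have h1 := hee a c z
  have h2 := heo a d z
  have h3 := heo c b z
  have h4 := S.jacobi_odd b d z
  rw [S.comm c b] at h3
  simp only [map_add, LinearMap.add_apply]
  grind

end LieSuperalgebra

noncomputable section

theorem kaehler_induction {K P : Type*} [Field K] [CommRing P] [Algebra K P]
    {p : Ω[P⁄K] → Prop} (zero : p 0)
    (add : ∀ x y, p x → p y → p (x + y)) (D : ∀ b : P, p (KaehlerDifferential.D K P b))
    (smul : ∀ (a : P) (x), p x → p (a • x)) (x : Ω[P⁄K]) : p x := by
  have hx : x ∈ Submodule.span P (Set.range (KaehlerDifferential.D K P)) := by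
    rw [KaehlerDifferential.span_range_derivation]; trivial
  induction hx using Submodule.span_induction with
  | mem x h => obtain ⟨b, rfl⟩ := h; exact D b
  | zero => exact zero
  | add x y _ _ hx hy => exact add x y hx hy
  | smul a x _ hx => exact smul a x hx

/-- Pairs `(u, v)` of differentials with the scalar action `a • (u, v) = (a u, a v + X(a) u)`. -/
def LieTwist {K P : Type*} [Field K] [CommRing P] [Algebra K P] (_X : Derivation K P P) :=
  Ω[P⁄K] × Ω[P⁄K]

namespace LieTwist
variable {K P : Type*} [Field K] [CommRing P] [Algebra K P] (X : Derivation K P P)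

instance : AddCommGroup (LieTwist X) := inferInstanceAs (AddCommGroup (Ω[P⁄K] × Ω[P⁄K]))
instance : Module K (LieTwist X) := inferInstanceAs (Module K (Ω[P⁄K] × Ω[P⁄K]))
instance : SMul P (LieTwist X) := ⟨fun a m => (a • m.1, a • m.2 + X a • m.1)⟩

@[ext] theorem ext {m n : LieTwist X} (h1 : m.1 = n.1) (h2 : m.2 = n.2) : m = n := Prod.ext h1 h2
@[simp] theorem smul_fst (a : P) (m : LieTwist X) : (a • m).1 = a • m.1 := rfl
@[simp] theorem smul_snd (a : P) (m : LieTwist X) : (a • m).2 = a • m.2 + X a • m.1 := rfl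
@[simp] theorem ksmul_fst (a : K) (m : LieTwist X) : (a • m).1 = a • m.1 := rfl
@[simp] theorem ksmul_snd (a : K) (m : LieTwist X) : (a • m).2 = a • m.2 := rfl
@[simp] theorem add_fst (m n : LieTwist X) : (m + n).1 = m.1 + n.1 := rfl
@[simp] theorem add_snd (m n : LieTwist X) : (m + n).2 = m.2 + n.2 := rfl
@[simp] theorem zero_fst : (0 : LieTwist X).1 = 0 := rfl
@[simp] theorem zero_snd : (0 : LieTwist X).2 = 0 := rfl

instance : Module P (LieTwist X) where
  one_smul m := by ext <;> simp
  mul_smul a b m := by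
    ext
    · simp [mul_smul]
    · simp only [smul_snd, smul_fst, Derivation.leibniz, smul_eq_mul]
      module
  smul_zero a := by ext <;> simp
  smul_add a m n := by
    ext
    · simp
    · simp only [smul_snd, add_snd, add_fst]; module
  add_smul a b m := by
    ext
    · simp [add_smul]
    · simp only [smul_snd, add_snd, map_add]; module
  zero_smul m := by ext <;> simp

instance : IsScalarTower K P (LieTwist X) where
  smul_assoc k a m := by
    ext
    · simp
    · simp [smul_add]

/-- The derivation `b ↦ (db, d(X b))`. -/
def der : Derivation K P (LieTwist X) :=
  Derivation.mk'
    ({ toFun := fun b => (KaehlerDifferential.D K P b, KaehlerDifferential.D K P (X b))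
       map_add' := fun a b => by ext <;> simp <;> rfl
       map_smul' := fun a b => by ext <;> simp <;> rfl } : P →ₗ[K] LieTwist X)
    (fun a b => by
      ext
      · exact Derivation.leibniz _ _ _
      · change KaehlerDifferential.D K P (X (a * b)) =
          (a • KaehlerDifferential.D K P (X b) + X a • KaehlerDifferential.D K P b) +
          (b • KaehlerDifferential.D K P (X a) + X b • KaehlerDifferential.D K P a)
        simp only [Derivation.leibniz, smul_eq_mul, map_add]
        abel)

theorem lift_fst (x : Ω[P⁄K]) : ((der X).liftKaehlerDifferential x).1 = x := by
  induction x using kaehler_induction with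
  | zero => simp
  | add x y hx hy => simp [hx, hy]
  | D b => rw [Derivation.liftKaehlerDifferential_comp_D]; rfl
  | smul a x hx => simp [hx]

end LieTwist

/-- The Lie derivative on differentials, `L_X (a db) = X(a) db + a d(X b)`. -/
def lieDeriv {K P : Type*} [Field K] [CommRing P] [Algebra K P] (X : Derivation K P P) :
    Ω[P⁄K] →ₗ[K] Ω[P⁄K] where
  toFun x := ((LieTwist.der X).liftKaehlerDifferential x).2
  map_add' x y := by simp
  map_smul' k x := by
    rw [LinearMap.map_smul_of_tower]; rfl

section LieDeriv
variable {K P : Type*} [Field K] [CommRing P] [Algebra K P] (X Y : Derivation K P P)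

theorem lieDeriv_D (b : P) :
    lieDeriv X (KaehlerDifferential.D K P b) = KaehlerDifferential.D K P (X b) := by
  change ((LieTwist.der X).liftKaehlerDifferential _).2 = _
  rw [Derivation.liftKaehlerDifferential_comp_D]; rfl

theorem lieDeriv_smul (a : P) (x : Ω[P⁄K]) :
    lieDeriv X (a • x) = a • lieDeriv X x + X a • x := by
  change ((LieTwist.der X).liftKaehlerDifferential _).2 = _
  rw [map_smul, LieTwist.smul_snd, LieTwist.lift_fst]; rfl

theorem lieDeriv_add_left (x : Ω[P⁄K]) : lieDeriv (X + Y) x = lieDeriv X x + lieDeriv Y x := by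
  induction x using kaehler_induction with
  | zero => simp
  | add x y hx hy => simp only [map_add, hx, hy]; abel
  | D b => simp [lieDeriv_D]
  | smul a x hx => simp only [lieDeriv_smul, hx, Derivation.add_apply]; module

/-- Cartan's formula for the dependence of `L_X` on `X`. -/
theorem lieDeriv_smul_left (f : P) (x : Ω[P⁄K]) : lieDeriv (f • X) x =
    f • lieDeriv X x + X.liftKaehlerDifferential x • KaehlerDifferential.D K P f := by
  induction x using kaehler_induction with
  | zero => simp
  | add x y hx hy => simp only [map_add, hx, hy]; module
  | D b => simp [lieDeriv_D]
  | smul a x hx =>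
    simp only [lieDeriv_smul, hx, Derivation.smul_apply, map_smul, smul_eq_mul]; module

theorem lieDeriv_ksmul_left (f : K) (x : Ω[P⁄K]) : lieDeriv (f • X) x = f • lieDeriv X x := by
  have := lieDeriv_smul_left X (algebraMap K P f) x
  simpa [algebraMap_smul] using this

end LieDeriv

namespace PoissonSuperalgebra
variable {K P : Type*} [Field K] [CharP K 2] [CommRing P] [Algebra K P]
  {𝒜 : ZMod 2 → Submodule K P} [GradedAlgebra 𝒜] (S : PoissonSuperalgebra K P 𝒜)

theorem leibniz_right (x y z : P) :
    S.bracket x (y * z) = y * S.bracket x z + z * S.bracket x y := by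
  rw [S.comm, S.leibniz, S.comm z, S.comm y]; ring

/-- The Hamiltonian derivation `{y, -}`. -/
def ham (y : P) : Derivation K P P :=
  Derivation.mk' (S.bracket y) (fun a b => S.leibniz_right y a b)

@[simp] theorem ham_apply (y z : P) : S.ham y z = S.bracket y z := rfl

/-- The anchor `ρ : Ω → Der(P)`, `x dy ↦ x {y, -}`. -/
def kaehlerAnchor : Ω[P⁄K] →ₗ[P] Derivation K P P :=
  (Derivation.mk'
    ({ toFun := S.ham
       map_add' := fun a b => by ext; simp
       map_smul' := fun a b => by ext; simp } : P →ₗ[K] Derivation K P P)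
    (fun a b => by
      ext c
      simp [S.leibniz, mul_comm (S.bracket a c)])).liftKaehlerDifferential

@[simp] theorem kaehlerAnchor_D (y : P) :
    S.kaehlerAnchor (KaehlerDifferential.D K P y) = S.ham y := by
  rw [kaehlerAnchor, Derivation.liftKaehlerDifferential_comp_D]; rfl

/-- The pairing `(x dy, z dw) ↦ x z {y, w}`. -/
def pairing (x y : Ω[P⁄K]) : P := (S.kaehlerAnchor x).liftKaehlerDifferential y

theorem lift_add (X Y : Derivation K P P) (x : Ω[P⁄K]) : (X + Y).liftKaehlerDifferential x =
    X.liftKaehlerDifferential x + Y.liftKaehlerDifferential x := by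
  induction x using kaehler_induction with
  | zero => simp
  | add x y hx hy => simp only [map_add, hx, hy]; abel
  | D b => simp
  | smul a x hx => simp only [map_smul, hx, smul_eq_mul]; ring

theorem lift_smul (f : P) (X : Derivation K P P) (x : Ω[P⁄K]) :
    (f • X).liftKaehlerDifferential x = f * X.liftKaehlerDifferential x := by
  induction x using kaehler_induction with
  | zero => simp
  | add x y hx hy => simp only [map_add, hx, hy]; ring
  | D b => simp
  | smul a x hx => simp only [map_smul, hx, smul_eq_mul]; ring

theorem pairing_add_left (x y z : Ω[P⁄K]) :
    S.pairing (x + y) z = S.pairing x z + S.pairing y z := by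
  simp [pairing, lift_add]

theorem pairing_add_right (x y z : Ω[P⁄K]) :
    S.pairing x (y + z) = S.pairing x y + S.pairing x z := by
  simp [pairing]

theorem pairing_smul_left (a : P) (x y : Ω[P⁄K]) :
    S.pairing (a • x) y = a * S.pairing x y := by
  simp [pairing, lift_smul]

theorem pairing_smul_right (a : P) (x y : Ω[P⁄K]) :
    S.pairing x (a • y) = a * S.pairing x y := by
  simp [pairing]

theorem pairing_D_right (x : Ω[P⁄K]) (b : P) :
    S.pairing x (KaehlerDifferential.D K P b) = S.kaehlerAnchor x b := by
  simp [pairing]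

theorem pairing_zero_left (x : Ω[P⁄K]) : S.pairing 0 x = 0 := by
  simpa using S.pairing_smul_left 0 0 x

theorem pairing_zero_right (x : Ω[P⁄K]) : S.pairing x 0 = 0 := by
  simpa using S.pairing_smul_right 0 x 0

theorem pairing_comm (x y : Ω[P⁄K]) : S.pairing x y = S.pairing y x := by
  induction x using kaehler_induction with
  | zero => rw [pairing_zero_left, pairing_zero_right]
  | add x z hx hz => rw [pairing_add_left, pairing_add_right, hx, hz]
  | smul a x hx => rw [pairing_smul_left, pairing_smul_right, hx]
  | D b =>
    rw [pairing_D_right]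
    induction y using kaehler_induction with
    | zero => simp [pairing_zero_right]
    | add x z hx hz => simp [pairing_add_right, hx, hz]
    | smul a x hx => simp [pairing_smul_right, hx]
    | D b => simp [pairing_D_right, S.comm]

theorem pairing_self (x : Ω[P⁄K]) : S.pairing x x = 0 := by
  induction x using kaehler_induction with
  | zero => exact S.pairing_zero_left 0
  | add x z hx hz =>
    rw [pairing_add_left, pairing_add_right, pairing_add_right, hx, hz, S.pairing_comm z x]
    simpa using add_self_eq_zero_of_charTwo K _
  | smul a x hx => rw [pairing_smul_left, pairing_smul_right, hx]; simp
  | D b => rw [pairing_D_right, kaehlerAnchor_D, ham_apply, S.alt]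

theorem anchor_ksmul (k : K) (x : Ω[P⁄K]) :
    S.kaehlerAnchor (k • x) = k • S.kaehlerAnchor x :=
  LinearMap.map_smul_of_tower _ _ _

/-- The bracket on differentials, `[ω, η] = L_{ρ(ω)} η + L_{ρ(η)} ω + d⟨ω, η⟩`; its values on
generators are given by `kaehlerBracket_formula`. -/
def kaehlerBracket : Ω[P⁄K] →ₗ[K] Ω[P⁄K] →ₗ[K] Ω[P⁄K] :=
  LinearMap.mk₂ K (fun x y => lieDeriv (S.kaehlerAnchor x) y + lieDeriv (S.kaehlerAnchor y) x
      + KaehlerDifferential.D K P (S.pairing x y))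
    (fun x y z => by simp only [map_add, lieDeriv_add_left, pairing_add_left]; abel)
    (fun k x y => by
      rw [anchor_ksmul, lieDeriv_ksmul_left, map_smul, ← algebraMap_smul P k x,
        pairing_smul_left, ← Algebra.smul_def, Derivation.map_smul, smul_add, smul_add])
    (fun x y z => by simp only [map_add, lieDeriv_add_left, pairing_add_right]; abel)
    (fun k x y => by
      rw [anchor_ksmul, lieDeriv_ksmul_left, map_smul, ← algebraMap_smul P k y,
        pairing_smul_right, ← Algebra.smul_def, Derivation.map_smul, smul_add, smul_add])

theorem kaehlerBracket_apply (x y : Ω[P⁄K]) : S.kaehlerBracket x y =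
    lieDeriv (S.kaehlerAnchor x) y + lieDeriv (S.kaehlerAnchor y) x
      + KaehlerDifferential.D K P (S.pairing x y) := rfl

theorem kaehlerBracket_comm (x y : Ω[P⁄K]) : S.kaehlerBracket x y = S.kaehlerBracket y x := by
  rw [kaehlerBracket_apply, kaehlerBracket_apply, S.pairing_comm x y, add_comm (lieDeriv _ y)]

theorem kaehlerBracket_self (x : Ω[P⁄K]) : S.kaehlerBracket x x = 0 := by
  rw [kaehlerBracket_apply, pairing_self, add_self_eq_zero_of_charTwo K]; simp

theorem kaehlerBracket_D_D (a b : P) :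
    S.kaehlerBracket (KaehlerDifferential.D K P a) (KaehlerDifferential.D K P b) =
      KaehlerDifferential.D K P (S.bracket a b) := by
  rw [kaehlerBracket_apply]
  simp only [lieDeriv_D, pairing_D_right, kaehlerAnchor_D, ham_apply, S.comm b a]
  rw [add_self_eq_zero_of_charTwo K, zero_add]

theorem kaehlerBracket_smul (a : P) (x y : Ω[P⁄K]) :
    S.kaehlerBracket x (a • y) = a • S.kaehlerBracket x y + S.kaehlerAnchor x a • y := by
  simp only [kaehlerBracket_apply, lieDeriv_smul, map_smul, lieDeriv_smul_left,
    pairing_smul_right, Derivation.leibniz]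
  have h : (S.kaehlerAnchor y).liftKaehlerDifferential x = S.pairing x y := S.pairing_comm y x
  rw [h]
  have h2 := add_self_eq_zero_of_charTwo K (S.pairing x y • KaehlerDifferential.D K P a)
  rw [← sub_eq_zero] at h2 ⊢
  rw [← h2]
  module

theorem kaehlerBracket_smul_left (a : P) (x y : Ω[P⁄K]) :
    S.kaehlerBracket (a • x) y = a • S.kaehlerBracket x y + S.kaehlerAnchor y a • x := by
  rw [kaehlerBracket_comm, kaehlerBracket_smul, kaehlerBracket_comm]

/-- The bracket on generators. -/
theorem kaehlerBracket_formula (x y z w : P) :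
    S.kaehlerBracket (x • KaehlerDifferential.D K P y) (z • KaehlerDifferential.D K P w) =
      (x * z) • KaehlerDifferential.D K P (S.bracket y w)
        + (x * S.bracket y z) • KaehlerDifferential.D K P w
        + (z * S.bracket w x) • KaehlerDifferential.D K P y := by
  rw [kaehlerBracket_smul, kaehlerBracket_smul_left, kaehlerBracket_D_D]
  simp only [map_smul, kaehlerAnchor_D, Derivation.smul_apply, ham_apply, smul_eq_mul]
  module

theorem kaehlerAnchor_bracket (x y : Ω[P⁄K]) (c : P) :
    S.kaehlerAnchor (S.kaehlerBracket x y) c =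
      S.kaehlerAnchor x (S.kaehlerAnchor y c) + S.kaehlerAnchor y (S.kaehlerAnchor x c) := by
  induction x using kaehler_induction with
  | zero => simp
  | add x z hx hz =>
    simp only [map_add, LinearMap.add_apply, Derivation.add_apply, hx, hz]; abel
  | smul a x hx =>
    rw [kaehlerBracket_smul_left]
    simp only [map_add, map_smul, Derivation.add_apply, Derivation.smul_apply, hx,
      Derivation.leibniz, smul_eq_mul]
    ring
  | D a =>
    induction y using kaehler_induction with
    | zero => simp
    | add x z hx hz =>
      simp only [map_add, Derivation.add_apply, hx, hz]; abel
    | smul b x hx =>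
      rw [kaehlerBracket_smul]
      simp only [map_add, map_smul, Derivation.add_apply, Derivation.smul_apply, hx,
        Derivation.leibniz, smul_eq_mul]
      ring
    | D b =>
      rw [kaehlerBracket_D_D]
      simp only [kaehlerAnchor_D, ham_apply, S.jacobi_all]

theorem kaehler_jacobi (x y z : Ω[P⁄K]) : S.kaehlerBracket (S.kaehlerBracket x y) z =
    S.kaehlerBracket x (S.kaehlerBracket y z) + S.kaehlerBracket y (S.kaehlerBracket x z) := by
  have two : (2 : P) = 0 := by
    have := add_self_eq_zero_of_charTwo K (1 : P)
    rwa [one_add_one_eq_two] at this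
  induction z using kaehler_induction with
  | zero => simp
  | add z w hz hw => simp only [map_add, hz, hw]; abel
  | smul a z hz =>
    simp only [kaehlerBracket_smul, hz, kaehlerAnchor_bracket, map_add]
    match_scalars <;> grind
  | D c =>
    induction y using kaehler_induction with
    | zero => simp
    | add z w hz hw => simp only [map_add, LinearMap.add_apply, hz, hw]; abel
    | smul a z hz =>
      simp only [kaehlerBracket_smul, kaehlerBracket_smul_left, hz, kaehlerAnchor_bracket, map_add,
        LinearMap.add_apply, kaehlerAnchor_D]
      match_scalars <;> grind
    | D b =>
      induction x using kaehler_induction with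
      | zero => simp
      | add z w hz hw => simp only [map_add, LinearMap.add_apply, hz, hw]; abel
      | smul a z hz =>
        simp only [kaehlerBracket_smul, kaehlerBracket_smul_left, hz,
          map_add, LinearMap.add_apply, kaehlerAnchor_D, kaehlerBracket_D_D, ham_apply,
          S.jacobi_all]
        rw [S.kaehlerBracket_comm (KaehlerDifferential.D K P b) z]
        match_scalars <;> grind
      | D a => simp only [kaehlerBracket_D_D, S.jacobi_all, map_add]

theorem proj_of_mem {i j : ZMod 2} {a : P} (h : a ∈ 𝒜 i) (hij : i ≠ j) :
    GradedAlgebra.proj 𝒜 j a = 0 := DirectSum.decompose_of_mem_ne 𝒜 h hij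

theorem proj_of_mem_same {i : ZMod 2} {a : P} (h : a ∈ 𝒜 i) :
    GradedAlgebra.proj 𝒜 i a = a := DirectSum.decompose_of_mem_same 𝒜 h

theorem proj_mem (i : ZMod 2) (a : P) : GradedAlgebra.proj 𝒜 i a ∈ 𝒜 i :=
  (DirectSum.decompose 𝒜 a i).2

theorem proj_add_proj (a : P) :
    GradedAlgebra.proj 𝒜 0 a + GradedAlgebra.proj 𝒜 1 a = a := by
  classical
  have h := DirectSum.sum_support_decompose 𝒜 a
  rw [Finset.sum_subset (Finset.subset_univ _)] at h
  · change ∑ i : Fin 2, (DirectSum.decompose 𝒜 a i : P) = a at h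
    rw [Fin.sum_univ_two] at h
    exact h
  · intro i _ hi
    simpa using hi

theorem mul_mem_of_eq {i j k : ZMod 2} (h : i + j = k) {a b : P} (ha : a ∈ 𝒜 i)
    (hb : b ∈ 𝒜 j) : a * b ∈ 𝒜 k := h ▸ SetLike.GradedMul.mul_mem ha hb

theorem proj_mul (a b : P) :
    GradedAlgebra.proj 𝒜 0 (a * b) = GradedAlgebra.proj 𝒜 0 a * GradedAlgebra.proj 𝒜 0 b +
      GradedAlgebra.proj 𝒜 1 a * GradedAlgebra.proj 𝒜 1 b ∧
    GradedAlgebra.proj 𝒜 1 (a * b) = GradedAlgebra.proj 𝒜 0 a * GradedAlgebra.proj 𝒜 1 b +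
      GradedAlgebra.proj 𝒜 1 a * GradedAlgebra.proj 𝒜 0 b := by
  have h00 := mul_mem_of_eq (k := 0) (by decide) (proj_mem (𝒜 := 𝒜) 0 a) (proj_mem (𝒜 := 𝒜) 0 b)
  have h01 := mul_mem_of_eq (k := 1) (by decide) (proj_mem (𝒜 := 𝒜) 0 a) (proj_mem (𝒜 := 𝒜) 1 b)
  have h10 := mul_mem_of_eq (k := 1) (by decide) (proj_mem (𝒜 := 𝒜) 1 a) (proj_mem (𝒜 := 𝒜) 0 b)
  have h11 := mul_mem_of_eq (k := 0) (by decide) (proj_mem (𝒜 := 𝒜) 1 a) (proj_mem (𝒜 := 𝒜) 1 b)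
  have e : a * b = (GradedAlgebra.proj 𝒜 0 a * GradedAlgebra.proj 𝒜 0 b +
      GradedAlgebra.proj 𝒜 1 a * GradedAlgebra.proj 𝒜 1 b) +
      (GradedAlgebra.proj 𝒜 0 a * GradedAlgebra.proj 𝒜 1 b +
      GradedAlgebra.proj 𝒜 1 a * GradedAlgebra.proj 𝒜 0 b) := by
    conv_lhs => rw [← proj_add_proj (𝒜 := 𝒜) a, ← proj_add_proj (𝒜 := 𝒜) b]
    ring
  have he := add_mem h00 h11
  have ho := add_mem h01 h10
  rw [e]
  constructor
  · rw [map_add, proj_of_mem_same he, proj_of_mem ho (by decide), add_zero]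
  · rw [map_add, proj_of_mem_same ho, proj_of_mem he (by decide), zero_add]

/-- Triples `(u, v, q)` of differentials with a twisted module structure, in which `u` and `v`
stand for the even and the odd part of a differential and `q` for the squaring of `v`. -/
@[ext] structure SqTwist (S : PoissonSuperalgebra K P 𝒜) where
  u : Ω[P⁄K]
  v : Ω[P⁄K]
  q : Ω[P⁄K]

namespace SqTwist
variable {S}

instance : Zero (SqTwist S) := ⟨⟨0, 0, 0⟩⟩
instance : Add (SqTwist S) :=
  ⟨fun m n => ⟨m.u + n.u, m.v + n.v, m.q + n.q + S.kaehlerBracket m.v n.v⟩⟩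
instance : Neg (SqTwist S) := ⟨fun m => m⟩

@[simp] theorem zero_u : (0 : SqTwist S).u = 0 := rfl
@[simp] theorem zero_v : (0 : SqTwist S).v = 0 := rfl
@[simp] theorem zero_q : (0 : SqTwist S).q = 0 := rfl
@[simp] theorem add_u (m n : SqTwist S) : (m + n).u = m.u + n.u := rfl
@[simp] theorem add_v (m n : SqTwist S) : (m + n).v = m.v + n.v := rfl
@[simp] theorem add_q (m n : SqTwist S) :
    (m + n).q = m.q + n.q + S.kaehlerBracket m.v n.v := rfl

instance : AddCommGroup (SqTwist S) where
  add_assoc a b c := by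
    ext
    · simp [add_assoc]
    · simp [add_assoc]
    · simp only [add_q, add_v, map_add, LinearMap.add_apply]; abel
  zero_add a := by ext <;> simp
  add_zero a := by ext <;> simp
  add_comm a b := by
    ext
    · simp [add_comm]
    · simp [add_comm]
    · simp only [add_q, S.kaehlerBracket_comm b.v, add_comm b.q]
  neg_add_cancel m := by
    have h := fun x : Ω[P⁄K] => add_self_eq_zero_of_charTwo K x
    ext
    · exact h _
    · exact h _
    · change m.q + m.q + S.kaehlerBracket m.v m.v = 0
      rw [h, S.kaehlerBracket_self, add_zero]
  nsmul := nsmulRec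
  zsmul := zsmulRec

instance : SMul P (SqTwist S) := ⟨fun a m =>
  let a0 := GradedAlgebra.proj 𝒜 0 a
  let a1 := GradedAlgebra.proj 𝒜 1 a
  ⟨a0 • m.u + a1 • m.v, a0 • m.v + a1 • m.u,
    a0 ^ 2 • m.q + (a0 * S.kaehlerAnchor m.v a0) • m.v + (a1 * S.kaehlerAnchor m.u a1) • m.u +
      S.kaehlerBracket (a0 • m.v) (a1 • m.u)⟩⟩

theorem smul_u (a : P) (m : SqTwist S) :
    (a • m).u = GradedAlgebra.proj 𝒜 0 a • m.u + GradedAlgebra.proj 𝒜 1 a • m.v := rfl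
theorem smul_v (a : P) (m : SqTwist S) :
    (a • m).v = GradedAlgebra.proj 𝒜 0 a • m.v + GradedAlgebra.proj 𝒜 1 a • m.u := rfl
theorem smul_q (a : P) (m : SqTwist S) : (a • m).q =
    GradedAlgebra.proj 𝒜 0 a ^ 2 • m.q +
    (GradedAlgebra.proj 𝒜 0 a * S.kaehlerAnchor m.v (GradedAlgebra.proj 𝒜 0 a)) • m.v +
    (GradedAlgebra.proj 𝒜 1 a * S.kaehlerAnchor m.u (GradedAlgebra.proj 𝒜 1 a)) • m.u +
      S.kaehlerBracket (GradedAlgebra.proj 𝒜 0 a • m.v) (GradedAlgebra.proj 𝒜 1 a • m.u) := rfl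

theorem two_eq_zero (K P : Type*) [Field K] [CharP K 2] [CommRing P] [Algebra K P] :
    (2 : P) = 0 := by
  have := add_self_eq_zero_of_charTwo K (1 : P)
  rwa [one_add_one_eq_two] at this

instance : Module P (SqTwist S) where
  one_smul m := by
    have h0 : GradedAlgebra.proj 𝒜 0 (1 : P) = 1 := proj_of_mem_same SetLike.GradedOne.one_mem
    have h1 : GradedAlgebra.proj 𝒜 1 (1 : P) = 0 :=
      proj_of_mem SetLike.GradedOne.one_mem (by decide)
    ext <;> simp [smul_u, smul_v, smul_q, h0, h1]
  smul_zero a := by ext <;> simp [smul_u, smul_v, smul_q]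
  zero_smul a := by ext <;> simp [smul_u, smul_v, smul_q]
  smul_add a m n := by
    ext
    · simp only [smul_u, add_u, add_v]; module
    · simp only [smul_v, add_u, add_v]; module
    · have two := two_eq_zero K P
      have ha := S.odd_mul_self _ (proj_mem (𝒜 := 𝒜) 1 a)
      simp only [smul_q, smul_v, add_q, add_u, add_v, map_add, LinearMap.add_apply,
        kaehlerBracket_smul, kaehlerBracket_smul_left, Derivation.add_apply, map_smul,
        Derivation.smul_apply, smul_eq_mul]
      rw [S.kaehlerBracket_comm m.u n.v]
      match_scalars <;> grind
  add_smul a b m := by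
    ext
    · simp only [smul_u, add_u, add_v, map_add]; module
    · simp only [smul_v, add_u, add_v, map_add]; module
    · have two := two_eq_zero K P
      simp only [smul_q, smul_v, add_q, map_add, LinearMap.add_apply,
        kaehlerBracket_smul, kaehlerBracket_smul_left, Derivation.add_apply, map_smul,
        Derivation.smul_apply, smul_eq_mul, kaehlerBracket_self]
      rw [S.kaehlerBracket_comm m.u m.v]
      match_scalars <;> grind
  mul_smul a b m := by
    have two := two_eq_zero K P
    have ha := S.odd_mul_self _ (proj_mem (𝒜 := 𝒜) 1 a)
    have hb := S.odd_mul_self _ (proj_mem (𝒜 := 𝒜) 1 b)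
    ext
    · simp only [smul_u, smul_v, (proj_mul a b).1, (proj_mul a b).2]; module
    · simp only [smul_u, smul_v, (proj_mul a b).1, (proj_mul a b).2]; module
    · simp only [smul_q, smul_v, smul_u, (proj_mul a b).1, (proj_mul a b).2, map_add,
        LinearMap.add_apply,
        kaehlerBracket_smul, kaehlerBracket_smul_left, Derivation.add_apply, map_smul,
        Derivation.smul_apply, smul_eq_mul, kaehlerBracket_self, Derivation.leibniz]
      rw [S.kaehlerBracket_comm m.u m.v]
      match_scalars <;> grind

instance : Module K (SqTwist S) := Module.compHom _ (algebraMap K P)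

instance : IsScalarTower K P (SqTwist S) := IsScalarTower.of_algebraMap_smul fun _ _ => rfl

theorem ksmul_eq (k : K) (m : SqTwist S) : k • m = ⟨k • m.u, k • m.v, k ^ 2 • m.q⟩ := by
  have h0 : GradedAlgebra.proj 𝒜 0 (algebraMap K P k) = algebraMap K P k :=
    proj_of_mem_same (SetLike.algebraMap_mem_graded 𝒜 k)
  have h1 : GradedAlgebra.proj 𝒜 1 (algebraMap K P k) = 0 :=
    proj_of_mem (SetLike.algebraMap_mem_graded 𝒜 k) (by decide)
  rw [← algebraMap_smul P k m]
  ext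
  · rw [smul_u, h0, h1, algebraMap_smul, zero_smul, add_zero]
  · rw [smul_v, h0, h1, algebraMap_smul, zero_smul, add_zero]
  · rw [smul_q, h0, h1, ← map_pow, algebraMap_smul, Derivation.map_algebraMap]
    simp

end SqTwist

theorem sq_add (x y : 𝒜 1) : (S.sq (x + y) : P) = S.sq x + S.sq y + S.bracket x y := by
  rw [S.bracket_odd]; ring

/-- The derivation `b ↦ (db₀, db₁, d s(b₁))`. -/
def sqDer : Derivation K P (SqTwist S) :=
  Derivation.mk'
    ({ toFun := fun b => ⟨KaehlerDifferential.D K P (GradedAlgebra.proj 𝒜 0 b),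
         KaehlerDifferential.D K P (GradedAlgebra.proj 𝒜 1 b),
         KaehlerDifferential.D K P (S.sq (DirectSum.decompose 𝒜 b 1))⟩
       map_add' := fun a b => by
         ext
         · simp
         · simp
         · simp only [SqTwist.add_q, kaehlerBracket_D_D, DirectSum.decompose_add,
             DirectSum.add_apply, sq_add, map_add]
           rfl
       map_smul' := fun k b => by
         rw [RingHom.id_apply, SqTwist.ksmul_eq]
         ext
         · simp
         · simp
         · simp only [DirectSum.decompose_smul, DirectSum.smul_apply, S.sq_smul,
             Submodule.coe_smul, Derivation.map_smul] } : P →ₗ[K] SqTwist S)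
    (fun a b => by
      have hab := proj_mul (𝒜 := 𝒜) a b
      have two := SqTwist.two_eq_zero K P
      have ha := S.odd_mul_self _ (proj_mem (𝒜 := 𝒜) 1 a)
      have hb := S.odd_mul_self _ (proj_mem (𝒜 := 𝒜) 1 b)
      have h01 := mul_mem_of_eq (k := 1) (by decide) (proj_mem (𝒜 := 𝒜) 0 a)
        (proj_mem (𝒜 := 𝒜) 1 b)
      have h10 := mul_mem_of_eq (k := 1) (by decide) (proj_mem (𝒜 := 𝒜) 0 b)
        (proj_mem (𝒜 := 𝒜) 1 a)
      have e : DirectSum.decompose 𝒜 (a * b) 1 = (⟨_, h01⟩ + ⟨_, h10⟩ : 𝒜 1) := by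
        ext
        exact hab.2.trans (by rw [mul_comm (GradedAlgebra.proj 𝒜 1 a)]; rfl)
      have s1 := S.sq_mul _ (proj_mem (𝒜 := 𝒜) 0 a) (DirectSum.decompose 𝒜 b 1) ⟨_, h01⟩ rfl
      have s2 := S.sq_mul _ (proj_mem (𝒜 := 𝒜) 0 b) (DirectSum.decompose 𝒜 a 1) ⟨_, h10⟩ rfl
      change (⟨KaehlerDifferential.D K P _, KaehlerDifferential.D K P _,
        KaehlerDifferential.D K P _⟩ : SqTwist S) =
        a • (⟨KaehlerDifferential.D K P _, KaehlerDifferential.D K P _,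
        KaehlerDifferential.D K P _⟩ : SqTwist S) +
        b • (⟨KaehlerDifferential.D K P _, KaehlerDifferential.D K P _,
        KaehlerDifferential.D K P _⟩ : SqTwist S)
      have e0 : (DirectSum.decompose 𝒜 a 1 : P) = GradedAlgebra.proj 𝒜 1 a := rfl
      have e1 : (DirectSum.decompose 𝒜 b 1 : P) = GradedAlgebra.proj 𝒜 1 b := rfl
      rw [e0] at s2
      rw [e1] at s1
      ext
      · simp only [SqTwist.add_u, SqTwist.smul_u, hab.1, map_add, Derivation.leibniz]; abel
      · simp only [SqTwist.add_v, SqTwist.smul_v, hab.2, map_add, Derivation.leibniz]; abel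
      · rw [e, sq_add, s1, s2]
        simp only [SqTwist.add_q, SqTwist.smul_q, SqTwist.smul_v]
        generalize S.sq (DirectSum.decompose 𝒜 a 1) = sa
        generalize S.sq (DirectSum.decompose 𝒜 b 1) = sb
        generalize GradedAlgebra.proj 𝒜 1 a = a1 at *
        generalize GradedAlgebra.proj 𝒜 1 b = b1 at *
        generalize GradedAlgebra.proj 𝒜 0 a = a0 at *
        generalize GradedAlgebra.proj 𝒜 0 b = b0 at *
        have c1 := S.comm a0 a1
        have c2 := S.comm b0 b1
        have c3 := S.comm a0 b0
        have c4 := S.comm a0 b1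
        have c5 := S.comm a1 b0
        have c6 := S.comm a1 b1
        simp only [kaehlerBracket_smul,
          kaehlerBracket_smul_left, kaehlerBracket_D_D, kaehlerAnchor_D, ham_apply, map_add,
          LinearMap.add_apply, Derivation.leibniz, leibniz_right, S.leibniz, map_smul,
          Derivation.smul_apply, smul_eq_mul, pow_two, S.alt, c1, c2, c3, c4, c5, c6]
        match_scalars <;> grind)


end PoissonSuperalgebra
end

noncomputable section

/-- The `ℤ/2`-grading on differentials, `|a db| = |a| + |b|`. -/
def kaehlerGrading {K P : Type*} [Field K] [CommRing P] [Algebra K P]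
    (𝒜 : ZMod 2 → Submodule K P) (k : ZMod 2) : Submodule K (Ω[P⁄K]) :=
  Submodule.span K {x | ∃ i j : ZMod 2, i + j = k ∧ ∃ a ∈ 𝒜 i, ∃ b ∈ 𝒜 j,
    x = a • KaehlerDifferential.D K P b}

namespace PoissonSuperalgebra

variable {K P : Type*} [Field K] [CharP K 2] [CommRing P] [Algebra K P]
  {𝒜 : ZMod 2 → Submodule K P} [GradedAlgebra 𝒜] (S : PoissonSuperalgebra K P 𝒜)

theorem eq_one_of_one_add {j : ZMod 2} : 1 + j = 0 → j = 1 := by revert j; decide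

theorem eq_zero_of_one_add {j : ZMod 2} : 1 + j = 1 → j = 0 := by revert j; decide

theorem smul_D_mem {i j k : ZMod 2} (h : i + j = k) {a b : P} (ha : a ∈ 𝒜 i) (hb : b ∈ 𝒜 j) :
    a • KaehlerDifferential.D K P b ∈ kaehlerGrading 𝒜 k :=
  Submodule.subset_span ⟨i, j, h, a, ha, b, hb, rfl⟩

theorem D_mem {i : ZMod 2} {b : P} (hb : b ∈ 𝒜 i) :
    KaehlerDifferential.D K P b ∈ kaehlerGrading 𝒜 i := by
  simpa using smul_D_mem (zero_add i) (SetLike.GradedOne.one_mem (A := 𝒜)) hb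

theorem smul_mem_grading {i j k : ZMod 2} (h : i + j = k) {a : P} (ha : a ∈ 𝒜 i)
    {x : Ω[P⁄K]} (hx : x ∈ kaehlerGrading 𝒜 j) : a • x ∈ kaehlerGrading 𝒜 k := by
  induction hx using Submodule.span_induction with
  | mem x hx =>
    obtain ⟨p, q, hpq, b, hb, c, hc, rfl⟩ := hx
    rw [smul_smul]
    exact smul_D_mem (by rw [add_assoc, hpq, h]) (SetLike.GradedMul.mul_mem ha hb) hc
  | zero => simp
  | add x y _ _ hx hy => rw [smul_add]; exact add_mem hx hy
  | smul c x _ hx => rw [smul_comm]; exact Submodule.smul_mem _ _ hx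

theorem grading_sup (x : Ω[P⁄K]) : x ∈ kaehlerGrading 𝒜 0 ⊔ kaehlerGrading 𝒜 1 := by
  induction x using kaehler_induction with
  | zero => exact zero_mem _
  | add x y hx hy => exact add_mem hx hy
  | D b =>
    rw [← proj_add_proj (𝒜 := 𝒜) b, map_add]
    exact Submodule.add_mem_sup (D_mem (proj_mem 0 b)) (D_mem (proj_mem 1 b))
  | smul a x hx =>
    obtain ⟨y, hy, z, hz, rfl⟩ := Submodule.mem_sup.1 hx
    have e : a • (y + z) = (GradedAlgebra.proj 𝒜 0 a • y + GradedAlgebra.proj 𝒜 1 a • z) +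
        (GradedAlgebra.proj 𝒜 1 a • y + GradedAlgebra.proj 𝒜 0 a • z) := by
      conv_lhs => rw [← proj_add_proj (𝒜 := 𝒜) a]
      module
    rw [e]
    exact Submodule.add_mem_sup
      (add_mem (smul_mem_grading (by decide) (proj_mem 0 a) hy)
        (smul_mem_grading (by decide) (proj_mem 1 a) hz))
      (add_mem (smul_mem_grading (by decide) (proj_mem 1 a) hy)
        (smul_mem_grading (by decide) (proj_mem 0 a) hz))

theorem kaehlerAnchor_mem {i j k : ZMod 2} (h : i + j = k) {x : Ω[P⁄K]}
    (hx : x ∈ kaehlerGrading 𝒜 i) {a : P} (ha : a ∈ 𝒜 j) : S.kaehlerAnchor x a ∈ 𝒜 k := by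
  induction hx using Submodule.span_induction with
  | mem x hx =>
    obtain ⟨p, q, hpq, b, hb, c, hc, rfl⟩ := hx
    rw [map_smul, Derivation.smul_apply, kaehlerAnchor_D, ham_apply, smul_eq_mul]
    exact mul_mem_of_eq (by rw [← add_assoc, hpq, h]) hb (S.bracket_mem _ _ _ hc _ ha)
  | zero => simp
  | add x y _ _ hx hy => rw [map_add]; exact add_mem hx hy
  | smul c x _ hx =>
    rw [anchor_ksmul, Derivation.smul_apply]; exact Submodule.smul_mem _ _ hx

theorem kaehlerBracket_mem {i j k : ZMod 2} (h : i + j = k) {x y : Ω[P⁄K]}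
    (hx : x ∈ kaehlerGrading 𝒜 i) (hy : y ∈ kaehlerGrading 𝒜 j) :
    S.kaehlerBracket x y ∈ kaehlerGrading 𝒜 k := by
  induction hx using Submodule.span_induction with
  | zero => simp
  | add x y _ _ hx hy => rw [map_add]; exact add_mem hx hy
  | smul c x _ hx => rw [map_smul]; exact Submodule.smul_mem _ _ hx
  | mem x hx =>
    obtain ⟨p, q, hpq, b, hb, c, hc, rfl⟩ := hx
    have hbc := smul_D_mem hpq hb hc
    rw [kaehlerBracket_smul_left]
    refine add_mem (smul_mem_grading (i := p) (j := q + j) (by rw [← add_assoc, hpq, h]) hb ?_)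
      (smul_mem_grading (i := j + p) (j := q) (by rw [← h, ← hpq]; ring)
        (S.kaehlerAnchor_mem rfl hy hb) (D_mem hc))
    induction hy using Submodule.span_induction with
    | zero => simp
    | add x y _ _ hx hy => rw [map_add]; exact add_mem hx hy
    | smul c x _ hx => rw [map_smul]; exact Submodule.smul_mem _ _ hx
    | mem y hy =>
      obtain ⟨r, s, hrs, d, hd, e, he, rfl⟩ := hy
      rw [kaehlerBracket_smul, kaehlerBracket_D_D, kaehlerAnchor_D]
      exact add_mem (smul_D_mem (by rw [← hrs]; ring) hd (S.bracket_mem _ _ _ hc _ he))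
        (smul_D_mem (by rw [← hrs]; ring) (S.bracket_mem _ _ _ hc _ hd) he)

/-- The `P`-linear map `ω ↦ (ω₀, ω₁, s(ω₁))`. -/
def sqLift : Ω[P⁄K] →ₗ[P] SqTwist S := S.sqDer.liftKaehlerDifferential

theorem sq_zero : S.sq 0 = 0 := by simpa using S.sq_smul 0 0

theorem sqLift_D (b : P) : S.sqLift (KaehlerDifferential.D K P b) =
    ⟨KaehlerDifferential.D K P (GradedAlgebra.proj 𝒜 0 b),
      KaehlerDifferential.D K P (GradedAlgebra.proj 𝒜 1 b),
      KaehlerDifferential.D K P (S.sq (DirectSum.decompose 𝒜 b 1))⟩ := by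
  rw [sqLift, Derivation.liftKaehlerDifferential_comp_D]; rfl

theorem sqLift_D_even {b : P} (hb : b ∈ 𝒜 0) : S.sqLift (KaehlerDifferential.D K P b) =
    ⟨KaehlerDifferential.D K P b, 0, 0⟩ := by
  have h : DirectSum.decompose 𝒜 b 1 = 0 := Subtype.ext (proj_of_mem hb (by decide))
  rw [sqLift_D, proj_of_mem_same hb, proj_of_mem hb (by decide), h, sq_zero]
  simp

theorem sqLift_D_odd {b : P} (hb : b ∈ 𝒜 1) : S.sqLift (KaehlerDifferential.D K P b) =
    ⟨0, KaehlerDifferential.D K P b, KaehlerDifferential.D K P (S.sq ⟨b, hb⟩)⟩ := by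
  have h : DirectSum.decompose 𝒜 b 1 = ⟨b, hb⟩ := Subtype.ext (proj_of_mem_same hb)
  rw [sqLift_D, proj_of_mem_same hb, proj_of_mem hb (by decide), h]
  simp

theorem smul_even {a : P} (ha : a ∈ 𝒜 0) (m : SqTwist S) :
    a • m = ⟨a • m.u, a • m.v, a ^ 2 • m.q + (a * S.kaehlerAnchor m.v a) • m.v⟩ := by
  ext
  · rw [SqTwist.smul_u, proj_of_mem_same ha, proj_of_mem ha (by decide)]; simp
  · rw [SqTwist.smul_v, proj_of_mem_same ha, proj_of_mem ha (by decide)]; simp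
  · rw [SqTwist.smul_q, proj_of_mem_same ha, proj_of_mem ha (by decide)]; simp

theorem smul_odd {a : P} (ha : a ∈ 𝒜 1) (m : SqTwist S) :
    a • m = ⟨a • m.v, a • m.u, (a * S.kaehlerAnchor m.u a) • m.u⟩ := by
  ext
  · rw [SqTwist.smul_u, proj_of_mem_same ha, proj_of_mem ha (by decide)]; simp
  · rw [SqTwist.smul_v, proj_of_mem_same ha, proj_of_mem ha (by decide)]; simp
  · rw [SqTwist.smul_q, proj_of_mem_same ha, proj_of_mem ha (by decide)]; simp

theorem sqLift_ksmul (k : K) (x : Ω[P⁄K]) : S.sqLift (k • x) =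
    ⟨k • (S.sqLift x).u, k • (S.sqLift x).v, k ^ 2 • (S.sqLift x).q⟩ := by
  rw [LinearMap.map_smul_of_tower, SqTwist.ksmul_eq]

theorem sqLift_even {x : Ω[P⁄K]} (hx : x ∈ kaehlerGrading 𝒜 0) : S.sqLift x = ⟨x, 0, 0⟩ := by
  induction hx using Submodule.span_induction with
  | zero => simp; rfl
  | add x y _ _ hx hy => rw [map_add, hx, hy]; ext <;> simp
  | smul c x _ hx => rw [sqLift_ksmul, hx]; simp
  | mem x hx =>
    obtain ⟨i, j, h, a, ha, b, hb, rfl⟩ := hx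
    rw [map_smul]
    rcases parity_cases i with rfl | rfl
    · obtain rfl : j = 0 := by simpa using h
      rw [sqLift_D_even S hb, smul_even S ha]; simp
    · obtain rfl := eq_one_of_one_add h
      rw [sqLift_D_odd S hb, smul_odd S ha]; simp

theorem sqLift_odd {x : Ω[P⁄K]} (hx : x ∈ kaehlerGrading 𝒜 1) :
    (S.sqLift x).u = 0 ∧ (S.sqLift x).v = x ∧ (S.sqLift x).q ∈ kaehlerGrading 𝒜 0 := by
  induction hx using Submodule.span_induction with
  | zero => simp
  | add x y hx' hy' hx hy =>
    rw [map_add]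
    simp only [SqTwist.add_u, SqTwist.add_v, SqTwist.add_q, hx.1, hx.2.1, hy.1, hy.2.1]
    refine ⟨add_zero _, trivial, add_mem (add_mem hx.2.2 hy.2.2)
      (S.kaehlerBracket_mem (by decide) hx' hy')⟩
  | smul c x _ hx =>
    rw [sqLift_ksmul]
    simp only [hx.1, hx.2.1]
    refine ⟨smul_zero _, trivial, Submodule.smul_mem _ _ hx.2.2⟩
  | mem x hx =>
    obtain ⟨i, j, h, a, ha, b, hb, rfl⟩ := hx
    rw [map_smul]
    rcases parity_cases i with rfl | rfl
    · obtain rfl : j = 1 := by simpa using h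
      rw [sqLift_D_odd S hb, smul_even S ha]
      refine ⟨smul_zero _, rfl, add_mem ?_ ?_⟩
      · rw [pow_two]
        exact smul_D_mem (i := 0 + 0) (by decide) (SetLike.GradedMul.mul_mem ha ha) (S.sq _).2
      · rw [kaehlerAnchor_D]
        exact smul_D_mem (i := 0 + (1 + 0)) (by decide)
          (SetLike.GradedMul.mul_mem ha (S.bracket_mem _ _ _ hb _ ha)) hb
    · obtain rfl := eq_zero_of_one_add h
      rw [sqLift_D_even S hb, smul_odd S ha]
      refine ⟨smul_zero _, rfl, ?_⟩
      rw [kaehlerAnchor_D]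
      exact smul_D_mem (i := 1 + (0 + 1)) (by decide)
          (SetLike.GradedMul.mul_mem ha (S.bracket_mem _ _ _ hb _ ha)) hb

theorem kaehler_isInternal (S : PoissonSuperalgebra K P 𝒜) :
    DirectSum.IsInternal (kaehlerGrading 𝒜) := by
  rw [isInternal_iff_isCompl]
  constructor
  · rw [Submodule.disjoint_def]
    intro x h0 h1
    have := (S.sqLift_odd h1).1
    rw [S.sqLift_even h0] at this
    exact this
  · rw [codisjoint_iff, eq_top_iff]
    intro x _
    exact grading_sup x

/-- The squaring on odd differentials; its values on generators are given by
`kaehlerSq_formula_even` and `kaehlerSq_formula_odd`, on sums by `kaehlerSq_add`. -/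
def kaehlerSq (x : kaehlerGrading 𝒜 1) : kaehlerGrading 𝒜 0 :=
  ⟨(S.sqLift x).q, (S.sqLift_odd x.2).2.2⟩

theorem coe_kaehlerSq (x : kaehlerGrading 𝒜 1) : (S.kaehlerSq x : Ω[P⁄K]) = (S.sqLift x).q := rfl

theorem kaehlerSq_add (x y : kaehlerGrading 𝒜 1) : (S.kaehlerSq (x + y) : Ω[P⁄K]) =
    S.kaehlerSq x + S.kaehlerSq y + S.kaehlerBracket x y := by
  simp only [coe_kaehlerSq, Submodule.coe_add, map_add, SqTwist.add_q, (S.sqLift_odd x.2).2.1,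
    (S.sqLift_odd y.2).2.1]

theorem kaehlerSq_smul_even {a : P} (ha : a ∈ 𝒜 0) (x ax : kaehlerGrading 𝒜 1)
    (h : (ax : Ω[P⁄K]) = a • (x : Ω[P⁄K])) : (S.kaehlerSq ax : Ω[P⁄K]) =
      a ^ 2 • (S.kaehlerSq x : Ω[P⁄K]) + (a * S.kaehlerAnchor x a) • (x : Ω[P⁄K]) := by
  rw [coe_kaehlerSq, h, map_smul, smul_even S ha, (S.sqLift_odd x.2).2.1]; rfl

theorem kaehlerSq_smul_odd {a : P} (ha : a ∈ 𝒜 1) (x : kaehlerGrading 𝒜 0)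
    (ax : kaehlerGrading 𝒜 1) (h : (ax : Ω[P⁄K]) = a • (x : Ω[P⁄K])) :
    (S.kaehlerSq ax : Ω[P⁄K]) = (a * S.kaehlerAnchor x a) • (x : Ω[P⁄K]) := by
  rw [coe_kaehlerSq, h, map_smul, smul_odd S ha, (S.sqLift_even x.2)]

theorem kaehlerSq_D (b : 𝒜 1) : (S.kaehlerSq ⟨KaehlerDifferential.D K P b, D_mem b.2⟩ : Ω[P⁄K]) =
    KaehlerDifferential.D K P (S.sq b) := by
  rw [coe_kaehlerSq, sqLift_D_odd S b.2]

/-- The squaring on generators with even coefficient. -/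
theorem kaehlerSq_formula_even (x : 𝒜 0) (y : 𝒜 1) :
    (S.kaehlerSq ⟨(x : P) • KaehlerDifferential.D K P y,
      smul_D_mem (zero_add 1) x.2 y.2⟩ : Ω[P⁄K]) =
      (x : P) ^ 2 • KaehlerDifferential.D K P (S.sq y) +
        ((x : P) * S.bracket x y) • KaehlerDifferential.D K P y := by
  rw [S.kaehlerSq_smul_even x.2 ⟨KaehlerDifferential.D K P y, D_mem y.2⟩ _ rfl, kaehlerSq_D,
    kaehlerAnchor_D, ham_apply, S.comm]

/-- The squaring on generators with odd coefficient. -/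
theorem kaehlerSq_formula_odd (x : 𝒜 1) (y : 𝒜 0) :
    (S.kaehlerSq ⟨(x : P) • KaehlerDifferential.D K P y,
      smul_D_mem (add_zero 1) x.2 y.2⟩ : Ω[P⁄K]) =
      ((x : P) * S.bracket x y) • KaehlerDifferential.D K P y := by
  rw [S.kaehlerSq_smul_odd x.2 ⟨KaehlerDifferential.D K P y, D_mem y.2⟩ _ rfl,
    kaehlerAnchor_D, ham_apply, S.comm]

theorem kaehlerBracket_D_sq (b : 𝒜 1) (y : Ω[P⁄K]) :
    S.kaehlerBracket (KaehlerDifferential.D K P (S.sq b)) y =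
      S.kaehlerBracket (KaehlerDifferential.D K P (b : P))
        (S.kaehlerBracket (KaehlerDifferential.D K P (b : P)) y) := by
  have two := SqTwist.two_eq_zero K P
  induction y using kaehler_induction with
  | zero => simp
  | add x y hx hy => simp only [map_add, hx, hy]
  | D c => simp only [kaehlerBracket_D_D, S.bracket_sq]
  | smul a x hx =>
    simp only [kaehlerBracket_smul, hx, map_add, kaehlerAnchor_D, ham_apply, S.bracket_sq]
    match_scalars <;> grind

theorem kaehlerBracket_sqLift {x : Ω[P⁄K]} (hx : x ∈ kaehlerGrading 𝒜 1) (y : Ω[P⁄K]) :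
    S.kaehlerBracket (S.sqLift x).q y = S.kaehlerBracket x (S.kaehlerBracket x y) := by
  have two := SqTwist.two_eq_zero K P
  induction hx using Submodule.span_induction with
  | zero => simp
  | add x z hx' hz' hx hz =>
    have h := S.kaehler_jacobi x z y
    simp only [map_add, SqTwist.add_q, LinearMap.add_apply, hx, hz, (S.sqLift_odd hx').2.1,
      (S.sqLift_odd hz').2.1, h]
    abel
  | smul c x _ hx =>
    rw [sqLift_ksmul]
    simp only [map_smul, LinearMap.smul_apply, hx, smul_smul, pow_two]
  | mem x hx =>
    obtain ⟨i, j, h, a, ha, b, hb, rfl⟩ := hx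
    rw [map_smul]
    have e := S.kaehlerAnchor_bracket (KaehlerDifferential.D K P b) y a
    rw [kaehlerAnchor_D] at e
    rcases parity_cases i with rfl | rfl
    · obtain rfl : j = 1 := by simpa using h
      rw [sqLift_D_odd S hb, smul_even S ha]
      simp only [kaehlerBracket_smul, kaehlerBracket_smul_left, map_add, LinearMap.add_apply,
        kaehlerAnchor_D, S.kaehlerBracket_D_sq ⟨b, hb⟩, map_smul, Derivation.smul_apply,
        Derivation.leibniz, smul_eq_mul, pow_two, kaehlerBracket_self, e, ham_apply]
      match_scalars <;> grind
    · obtain rfl := eq_zero_of_one_add h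
      have ha2 := S.odd_mul_self a ha
      rw [sqLift_D_even S hb, smul_odd S ha]
      simp only [kaehlerBracket_smul, kaehlerBracket_smul_left, map_add, LinearMap.add_apply,
        kaehlerAnchor_D, map_smul, Derivation.smul_apply,
        Derivation.leibniz, smul_eq_mul, kaehlerBracket_self, e, ham_apply]
      match_scalars <;> grind

theorem kaehlerAnchor_sqLift {x : Ω[P⁄K]} (hx : x ∈ kaehlerGrading 𝒜 1) (c : P) :
    S.kaehlerAnchor (S.sqLift x).q c = S.kaehlerAnchor x (S.kaehlerAnchor x c) := by
  have two := SqTwist.two_eq_zero K P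
  induction hx using Submodule.span_induction with
  | zero => simp
  | add x z hx' hz' hx hz =>
    have h := S.kaehlerAnchor_bracket x z c
    simp only [map_add, SqTwist.add_q, Derivation.add_apply, hx, hz, (S.sqLift_odd hx').2.1,
      (S.sqLift_odd hz').2.1, h]
    abel
  | smul k x _ hx =>
    rw [sqLift_ksmul]
    simp only [anchor_ksmul, Derivation.smul_apply, Derivation.map_smul, hx, smul_smul, pow_two]
  | mem x hx =>
    obtain ⟨i, j, h, a, ha, b, hb, rfl⟩ := hx
    rw [map_smul]
    rcases parity_cases i with rfl | rfl
    · obtain rfl : j = 1 := by simpa using h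
      have e := S.bracket_sq ⟨b, hb⟩ c
      rw [sqLift_D_odd S hb, smul_even S ha]
      simp only [map_add, kaehlerAnchor_D, map_smul, Derivation.smul_apply, Derivation.add_apply,
        Derivation.leibniz, smul_eq_mul, ham_apply, e]
      grind
    · obtain rfl := eq_zero_of_one_add h
      have ha2 := S.odd_mul_self a ha
      rw [sqLift_D_even S hb, smul_odd S ha]
      simp only [map_add, kaehlerAnchor_D, map_smul, Derivation.smul_apply, Derivation.add_apply,
        Derivation.leibniz, smul_eq_mul, ham_apply]
      grind

/-- The Lie-Rinehart superalgebra `(P, Ω_P, ρ)` of differentials of a Poisson superalgebra, with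
the anchor `ρ(x dy) = x {y, -}`, the bracket
`[x dy, z dw] = x z d{y, w} + x {y, z} dw + z {w, x} dy`, and the squaring with
`s(x dy) = x² d s(y) + x {x, y} dy` for even `x` and odd `y`, and `s(x dy) = x {x, y} dy` for odd `x`
and even `y`, extended to sums by `s(ω + η) = s(ω) + s(η) + [ω, η]`. -/
def kaehlerLieRinehart : LieRinehartSuperalgebra K P (Ω[P⁄K]) 𝒜 (kaehlerGrading 𝒜) where
  isInternal := S.kaehler_isInternal
  bracket := S.kaehlerBracket
  sq := S.kaehlerSq
  bracket_mem i j x hx y hy := S.kaehlerBracket_mem rfl hx hy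
  bracket_self x _ := S.kaehlerBracket_self x
  jacobi x _ y _ z := by rw [S.kaehler_jacobi, sub_eq_add_of_charTwo K]
  bracket_comm x _ y _ := S.kaehlerBracket_comm y x
  sq_smul k x := by
    ext
    rw [coe_kaehlerSq, Submodule.coe_smul, sqLift_ksmul]; rfl
  bracket_odd x y := by rw [S.kaehlerSq_add]; abel
  bracket_sq x y := S.kaehlerBracket_sqLift x.2 y
  odd_mul_self := S.odd_mul_self
  smul_mem i j a ha x hx := smul_mem_grading rfl ha hx
  anchor := S.kaehlerAnchor
  anchor_mem i j x hx a ha := S.kaehlerAnchor_mem rfl hx ha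
  anchor_bracket x _ y := by
    ext a
    rw [S.kaehlerAnchor_bracket, Derivation.commutator_apply, sub_eq_add_of_charTwo K]
  anchor_sq x a := by
    exact S.kaehlerAnchor_sqLift x.2 a
  bracket_smul := S.kaehlerBracket_smul
  sq_smul_even a ha x ax h := by
    rw [S.kaehlerSq_smul_even ha x ax h, map_smul]; rfl
  sq_smul_odd a ha x ax h := by
    rw [S.kaehlerSq_smul_odd ha x ax h, map_smul]; rfl

end PoissonSuperalgebra
end

noncomputable section

/-- The quotient of a non-unital ring by a two-sided ideal. -/
def IdealQuotient {R : Type*} [NonUnitalRing R] (I : TwoSidedIdeal R) : Type _ :=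
  I.ringCon.Quotient

namespace IdealQuotient

section Ring
variable {R : Type*} [NonUnitalRing R] (I : TwoSidedIdeal R)

instance : NonUnitalRing (IdealQuotient I) :=
  inferInstanceAs (NonUnitalRing I.ringCon.Quotient)

/-- The quotient map. -/
def mk : R →ₙ+* IdealQuotient I where
  toFun x := (x : I.ringCon.Quotient)
  map_zero' := rfl
  map_add' _ _ := rfl
  map_mul' _ _ := rfl

theorem mk_surjective : Function.Surjective (mk I) := Quotient.mk''_surjective

theorem mk_eq {x y : R} : mk I x = mk I y ↔ x - y ∈ I := by
  rw [← TwoSidedIdeal.rel_iff]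
  exact RingCon.eq _

end Ring

variable {K R : Type*} [Field K] [NonUnitalRing R] [Module K R] (I : TwoSidedIdeal R)

/-- The vector space structure on the quotient by an ideal that is a subspace. -/
abbrev module (h : ∀ (k : K) (x : R), x ∈ I → k • x ∈ I) : Module K (IdealQuotient I) :=
  letI : SMul K (IdealQuotient I) :=
    ⟨fun k => Quotient.map' (fun x => k • x) (fun x y hxy => by
      have hxy' : x - y ∈ I := (TwoSidedIdeal.rel_iff I x y).1 hxy
      have := h k _ hxy'
      rw [smul_sub] at this
      exact (TwoSidedIdeal.rel_iff I _ _).2 this)⟩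
  Function.Surjective.module K (mk I : R →+ IdealQuotient I) (mk_surjective I)
    (fun _ _ => rfl)

end IdealQuotient


end

noncomputable section

namespace LieSuperalgebra
variable {K L : Type*} [Field K] [AddCommGroup L] [Module K L]
    {ℒ : ZMod 2 → Submodule K L} (S : LieSuperalgebra K L ℒ)

/-- The relations `x ⊗ y + y ⊗ x = [x, y]` and `z ⊗ z = s(z)` for odd `z`. -/
inductive EnvRel : TensorAlgebra K L → TensorAlgebra K L → Prop
  | bracket (x y : L) : EnvRel (TensorAlgebra.ι K x * TensorAlgebra.ι K y +
      TensorAlgebra.ι K y * TensorAlgebra.ι K x) (TensorAlgebra.ι K (S.bracket x y))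
  | sq (z : ℒ 1) : EnvRel (TensorAlgebra.ι K (z : L) * TensorAlgebra.ι K (z : L))
      (TensorAlgebra.ι K (S.sq z : L))

/-- The universal enveloping algebra of a Lie superalgebra in characteristic `2`, the quotient of
the tensor algebra by these relations. -/
def Env : Type _ := RingQuot S.EnvRel

instance : Ring S.Env := inferInstanceAs (Ring (RingQuot S.EnvRel))

instance : Algebra K S.Env := inferInstanceAs (Algebra K (RingQuot S.EnvRel))

/-- The quotient map `T(L) → U(L)`. -/
def mkEnv : TensorAlgebra K L →ₐ[K] S.Env := RingQuot.mkAlgHom K S.EnvRel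

/-- The canonical map from a Lie superalgebra to its universal enveloping algebra. -/
def envι : L →ₗ[K] S.Env := S.mkEnv.toLinearMap ∘ₗ TensorAlgebra.ι K

end LieSuperalgebra

namespace LieRinehartSuperalgebra
variable {K A L : Type*} [Field K] [CharP K 2] [CommRing A] [Algebra K A]
    {𝒜 : ZMod 2 → Submodule K A} [GradedAlgebra 𝒜] [AddCommGroup L] [Module K L] [Module A L]
    [IsScalarTower K A L] {ℒ : ZMod 2 → Submodule K L} (S : LieRinehartSuperalgebra K A L 𝒜 ℒ)

theorem anchor_bracket_all (x y : L) (a : A) : S.anchor (S.bracket x y) a =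
    S.anchor x (S.anchor y a) + S.anchor y (S.anchor x a) := by
  have he : ∀ (x : ℒ 0) (y : L), S.anchor (S.bracket x y) a =
      S.anchor x (S.anchor y a) + S.anchor y (S.anchor x a) := fun x y => by
    rw [S.anchor_bracket x x.2, Derivation.commutator_apply, sub_eq_add_of_charTwo K]
  obtain ⟨x0, x1, rfl⟩ := S.exists_parts x
  obtain ⟨y0, y1, rfl⟩ := S.exists_parts y
  have h1 := he x0 y0
  have h2 := he x0 y1
  have h3 := he y0 x1
  have h4 : S.anchor (S.bracket x1 y1) a =
      S.anchor x1 (S.anchor y1 a) + S.anchor y1 (S.anchor x1 a) := by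
    rw [S.bracket_odd]
    simp only [map_sub, Derivation.sub_apply, S.anchor_sq, Submodule.coe_add, map_add,
      Derivation.add_apply]
    abel
  rw [S.comm] at h3
  simp only [map_add, LinearMap.add_apply, Derivation.add_apply, h1, h2, h3, h4]
  abel

theorem anchor_ksmul (k : K) (x : L) : S.anchor (k • x) = k • S.anchor x :=
  LinearMap.map_smul_of_tower _ _ _

/-- The bracket `[a + x, b + y] = ρ_x(b) + ρ_y(a) + [x, y]` on `A ⊕ L`. -/
def sumBracket : A × L →ₗ[K] A × L →ₗ[K] A × L :=
  LinearMap.mk₂ K (fun p q => (S.anchor p.2 q.1 + S.anchor q.2 p.1, S.bracket p.2 q.2))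
    (fun p q r => by
      ext
      · simp only [Prod.fst_add, Prod.snd_add, map_add, Derivation.add_apply]; abel
      · simp)
    (fun k p q => by
      ext
      · simp only [Prod.smul_fst, Prod.smul_snd, anchor_ksmul, Derivation.smul_apply,
          Derivation.map_smul, smul_add]
      · simp)
    (fun p q r => by
      ext
      · simp only [Prod.fst_add, Prod.snd_add, map_add, Derivation.add_apply]; abel
      · simp)
    (fun k p q => by
      ext
      · simp only [Prod.smul_fst, Prod.smul_snd, anchor_ksmul, Derivation.smul_apply,
          Derivation.map_smul, smul_add]
      · simp)

theorem sumBracket_apply (p q : A × L) : S.sumBracket p q =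
    (S.anchor p.2 q.1 + S.anchor q.2 p.1, S.bracket p.2 q.2) := rfl

/-- The grading on `A ⊕ L`. -/
def sumGrading (_S : LieRinehartSuperalgebra K A L 𝒜 ℒ) (k : ZMod 2) : Submodule K (A × L) :=
  (𝒜 k).prod (ℒ k)

/-- The squaring `s(a + x) = ρ_x(a) + s(x)` on `A ⊕ L`. -/
def sumSq (p : S.sumGrading 1) : S.sumGrading 0 :=
  ⟨(S.anchor p.1.2 p.1.1, S.sq ⟨p.1.2, p.2.2⟩),
    S.anchor_mem 1 1 _ p.2.2 _ p.2.1, (S.sq ⟨p.1.2, p.2.2⟩).2⟩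

/-- The Lie superalgebra `A ⊕ L`. -/
def directSum : LieSuperalgebra K (A × L) S.sumGrading where
  isInternal := by
    have hA := (isInternal_iff_isCompl 𝒜).1 (DirectSum.Decomposition.isInternal 𝒜)
    have hL := (isInternal_iff_isCompl ℒ).1 S.isInternal
    rw [isInternal_iff_isCompl]
    constructor
    · rw [disjoint_iff, sumGrading, sumGrading, Submodule.prod_inf_prod, hA.inf_eq_bot,
        hL.inf_eq_bot, Submodule.prod_bot]
    · rw [codisjoint_iff, sumGrading, sumGrading, Submodule.prod_sup_prod, hA.sup_eq_top,
        hL.sup_eq_top, Submodule.prod_top]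
  bracket := S.sumBracket
  sq := S.sumSq
  bracket_mem i j p hp q hq := by
    refine ⟨add_mem (S.anchor_mem i j _ hp.2 _ hq.1) ?_, S.bracket_mem i j _ hp.2 _ hq.2⟩
    rw [add_comm i j]
    exact S.anchor_mem j i _ hq.2 _ hp.1
  bracket_self p _ := by
    rw [sumBracket_apply, add_self_eq_zero_of_charTwo K, S.alt]; rfl
  jacobi p _ q _ r := by
    rw [sub_eq_add_of_charTwo K]
    simp only [sumBracket_apply, S.jacobi_all, S.anchor_bracket_all, map_add]
    have h := fun x : A => add_self_eq_zero_of_charTwo K x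
    ext
    · have h1 := h (S.anchor q.2 (S.anchor r.2 p.1))
      have h2 := h (S.anchor p.2 (S.anchor r.2 q.1))
      simp only [Prod.fst_add]
      grind
    · rfl
  bracket_comm p _ q _ := by
    rw [sumBracket_apply, sumBracket_apply, S.comm, add_comm]
  sq_smul k p := by
    have h := S.sq_smul k ⟨p.1.2, p.2.2⟩
    ext
    · change S.anchor (k • p.1.2) (k • p.1.1) = k ^ 2 • S.anchor p.1.2 p.1.1
      rw [anchor_ksmul, Derivation.smul_apply, Derivation.map_smul, smul_smul, pow_two]
    · exact congrArg Subtype.val h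
  bracket_odd p q := by
    have h := S.bracket_odd ⟨p.1.2, p.2.2⟩ ⟨q.1.2, q.2.2⟩
    rw [sumBracket_apply]
    ext
    · change _ = S.anchor (p.1.2 + q.1.2) (p.1.1 + q.1.1) - S.anchor p.1.2 p.1.1 -
        S.anchor q.1.2 q.1.1
      simp only [map_add, Derivation.add_apply]
      abel
    · exact h
  bracket_sq p q := by
    have h := S.bracket_sq ⟨p.1.2, p.2.2⟩ q.2
    ext
    · change S.anchor (S.sq ⟨p.1.2, p.2.2⟩) q.1 + S.anchor q.2 (S.anchor p.1.2 p.1.1) =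
        S.anchor p.1.2 (S.anchor p.1.2 q.1 + S.anchor q.2 p.1.1) +
          S.anchor (S.bracket p.1.2 q.2) p.1.1
      rw [S.anchor_sq, S.anchor_bracket_all, map_add]
      have h1 := add_self_eq_zero_of_charTwo K (S.anchor p.1.2 (S.anchor q.2 p.1.1))
      grind
    · exact h

/-- The (non-unital) subalgebra of the enveloping algebra of `A ⊕ L` generated by the image
of `A ⊕ L`. -/
abbrev envBar : NonUnitalSubalgebra K S.directSum.Env :=
  NonUnitalAlgebra.adjoin K (Set.range S.directSum.envι)

/-- The canonical map `i : A ⊕ L → Ū(A ⊕ L)`. -/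
def barι : A × L →ₗ[K] S.envBar where
  toFun p := ⟨S.directSum.envι p, NonUnitalAlgebra.subset_adjoin K ⟨p, rfl⟩⟩
  map_add' p q := by ext; simp
  map_smul' k p := by ext; simp

/-- The two-sided ideal generated by the elements `i(a) i(b + x) + i(ab + ax)`. -/
def envIdeal : TwoSidedIdeal S.envBar :=
  TwoSidedIdeal.span {u | ∃ (a b : A) (x : L),
    u = S.barι (a, 0) * S.barι (b, x) + S.barι (a * b, a • x)}

theorem smul_mem_envIdeal (k : K) {u : S.envBar} (hu : u ∈ S.envIdeal) :
    k • u ∈ S.envIdeal := by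
  induction hu using TwoSidedIdeal.span_induction with
  | mem u hu =>
    obtain ⟨a, b, x, rfl⟩ := hu
    refine TwoSidedIdeal.subset_span ⟨k • a, b, x, ?_⟩
    have h1 : ((k • a, 0) : A × L) = k • (a, 0) := by simp
    have h2 : (((k • a) * b, (k • a) • x) : A × L) = k • (a * b, a • x) := by simp
    rw [h1, h2, map_smul, map_smul, smul_mul_assoc, smul_add]
  | zero => rw [smul_zero]; exact zero_mem _
  | add x y _ _ hx hy => rw [smul_add]; exact add_mem hx hy
  | neg x _ hx => rw [smul_neg]; exact neg_mem hx
  | left_absorb a x _ hx => rw [← mul_smul_comm]; exact S.envIdeal.mul_mem_left _ _ hx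
  | right_absorb a x _ hx => rw [← smul_mul_assoc]; exact S.envIdeal.mul_mem_right _ _ hx

/-- The universal enveloping algebra `U(A, L, ρ) = Ū(A ⊕ L) / J`. -/
def U : Type _ := IdealQuotient S.envIdeal

instance : NonUnitalRing S.U := inferInstanceAs (NonUnitalRing (IdealQuotient S.envIdeal))

instance : Module K S.U := IdealQuotient.module S.envIdeal (fun k _ h => S.smul_mem_envIdeal k h)

/-- The quotient map `Ū(A ⊕ L) → U(A, L, ρ)`. -/
def mkU : S.envBar →ₙ+* S.U := IdealQuotient.mk S.envIdeal

theorem mkU_surjective : Function.Surjective S.mkU := IdealQuotient.mk_surjective _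

theorem mkU_smul (k : K) (x : S.envBar) : S.mkU (k • x) = k • S.mkU x := rfl

instance : IsScalarTower K S.U S.U where
  smul_assoc k x y := by
    obtain ⟨x, rfl⟩ := S.mkU_surjective x
    obtain ⟨y, rfl⟩ := S.mkU_surjective y
    simp only [smul_eq_mul, ← mkU_smul, ← map_mul, smul_mul_assoc]

instance : SMulCommClass K S.U S.U where
  smul_comm k x y := by
    obtain ⟨x, rfl⟩ := S.mkU_surjective x
    obtain ⟨y, rfl⟩ := S.mkU_surjective y
    simp only [smul_eq_mul, ← mkU_smul, ← map_mul, mul_smul_comm]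

/-- The canonical map `A ⊕ L → U(A, L, ρ)`. -/
def ι : A × L →ₗ[K] S.U where
  toFun p := S.mkU (S.barι p)
  map_add' p q := by simp
  map_smul' k p := by rw [map_smul, mkU_smul]; rfl

theorem ι_mul (a b : A) (x : L) : S.ι (a, 0) * S.ι (b, x) = S.ι (a * b, a • x) := by
  have h : S.barι (a, 0) * S.barι (b, x) + S.barι (a * b, a • x) ∈ S.envIdeal :=
    TwoSidedIdeal.subset_span ⟨a, b, x, rfl⟩
  change S.mkU _ * S.mkU _ = S.mkU _
  rw [← map_mul]
  refine (IdealQuotient.mk_eq _).2 ?_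
  rwa [sub_eq_add_of_charTwo K]

/-- The canonical morphism `i_A : A → U(A, L, ρ)`. -/
def ιA : A →ₙₐ[K] S.U where
  toFun a := S.ι (a, 0)
  map_smul' k a := by rw [← map_smul]; simp
  map_zero' := map_zero S.ι
  map_add' a b := by rw [← map_add]; simp
  map_mul' a b := by rw [ι_mul, smul_zero]

/-- The canonical map `i_L : L → U(A, L, ρ)`. -/
def ιL : L →ₗ[K] S.U := S.ι ∘ₗ LinearMap.inr K A L

/-- Products of images of homogeneous elements of `A ⊕ L`, with their total degree. -/
inductive IsMonomial : ZMod 2 → S.U → Prop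
  | ι (k : ZMod 2) (p : A × L) (hp : p ∈ S.sumGrading k) : IsMonomial k (S.ι p)
  | mul (i j : ZMod 2) (u v : S.U) : IsMonomial i u → IsMonomial j v → IsMonomial (i + j) (u * v)

/-- The `ℤ/2`-grading on `U(A, L, ρ)` induced by the grading of `A ⊕ L`. -/
def grading (k : ZMod 2) : Submodule K S.U := Submodule.span K {u | S.IsMonomial k u}

end LieRinehartSuperalgebra

end

/-!
The algebra `U(A, L, ρ)` of a Lie-Rinehart superalgebra represents the linear maps `φ` from `A ⊕ L`
to a not necessarily unital algebra with `φ[p, q] = φ(p) φ(q) + φ(q) φ(p)`, `φ(s(z)) = φ(z)²` for odd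
`z` and `φ(a) φ(b + x) = φ(ab + ax)` (`IsEnvMap`, `exists_lift`, `algHom_ext`): such a `φ` extends to
the unital enveloping algebra of `A ⊕ L` with values in the unitization of the target, and the
non-unital subalgebra generated by `A ⊕ L` lands in the target itself.

This universal property also yields the grading. In characteristic `2` the parity automorphism is
trivial and of no use to separate the even from the odd part, but the map `p ↦ p ⊗ e_k`, for `p` of
degree `k`, satisfies the relations in `U ⊗ K[ℤ/2]`, realized by `ℤ/2 × ℤ/2` matrices over `U`. Its
extension to `U` sends `u` of degree `k` to `u ⊗ e_k`, so the two pieces meet in `0`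
(`isInternal_grading`).

Let `(B, m, h)` be an enveloping triple of a Poisson superalgebra `P`. The condition
`h(xy) = m(x) h(y) + m(y) h(x)` forces `h` to take values in `m(1) B`, a unital `P`-module, on which
`h` is a derivation; so it extends to `H : Ω_P → B` with `H(x dy) = m(x) h(y)`
(`exists_kaehlerLift`). The commutation rule `H(ω) m(b) + m(b) H(ω) = m(ρ_ω(b))`, a consequence
of `uea2`, shows that `a + ω ↦ m(a) + H(ω)` satisfies the relations (`IsEnvelopingTriple.isEnvMap`),
and the universal property provides `f`. Uniqueness holds because `i_P(P)` and `i_Ω(dP)` generate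
`U(P, Ω_P)`. Conversely the relations of `U(P, Ω_P)` give the conditions on a triple; `uea3` and `uea4`
follow from `uea2` and `{x, x} = 0`.
-/

noncomputable section

/-! ### Universal property of the enveloping algebra of a Lie superalgebra -/

namespace LieSuperalgebra
variable {K L : Type*} [Field K] [AddCommGroup L] [Module K L]
    {ℒ : ZMod 2 → Submodule K L} (S : LieSuperalgebra K L ℒ)

theorem envι_bracket (x y : L) :
    S.envι x * S.envι y + S.envι y * S.envι x = S.envι (S.bracket x y) := by
  have h := RingQuot.mkAlgHom_rel K (EnvRel.bracket (S := S) x y)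
  rw [map_add, map_mul, map_mul] at h
  exact h

theorem envι_sq (z : ℒ 1) : S.envι (z : L) * S.envι (z : L) = S.envι (S.sq z : L) := by
  have h := RingQuot.mkAlgHom_rel K (EnvRel.sq (S := S) z)
  rw [map_mul] at h
  exact h

/-- The existence part of the universal property of the enveloping algebra. -/
theorem exists_envLift {C : Type*} [Ring C] [Algebra K C] (φ : L →ₗ[K] C)
    (hb : ∀ x y, φ x * φ y + φ y * φ x = φ (S.bracket x y))
    (hs : ∀ z : ℒ 1, φ z * φ z = φ (S.sq z)) :
    ∃ F : S.Env →ₐ[K] C, ∀ x, F (S.envι x) = φ x := by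
  refine ⟨RingQuot.liftAlgHom K ⟨TensorAlgebra.lift K φ, fun {a b} hab => ?_⟩, fun x => ?_⟩
  · cases hab with
    | bracket x y => simpa using hb x y
    | sq z => simpa using hs z
  · refine (RingQuot.liftAlgHom_mkAlgHom_apply K _ _ _).trans ?_
    exact TensorAlgebra.lift_ι_apply φ x

end LieSuperalgebra

namespace LieRinehartSuperalgebra
variable {K A L : Type*} [Field K] [CharP K 2] [CommRing A] [Algebra K A]
    {𝒜 : ZMod 2 → Submodule K A} [GradedAlgebra 𝒜] [AddCommGroup L] [Module K L] [Module A L]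
    [IsScalarTower K A L] {ℒ : ZMod 2 → Submodule K L} (S : LieRinehartSuperalgebra K A L 𝒜 ℒ)

/-! ### Universal property of `U(A, L, ρ)` -/

theorem ι_bracket (p q : A × L) :
    S.ι p * S.ι q + S.ι q * S.ι p = S.ι (S.sumBracket p q) := by
  change S.mkU (S.barι p) * S.mkU (S.barι q) + S.mkU (S.barι q) * S.mkU (S.barι p) =
    S.mkU (S.barι (S.sumBracket p q))
  rw [← map_mul S.mkU, ← map_mul S.mkU, ← map_add S.mkU]
  exact congrArg S.mkU (Subtype.ext (S.directSum.envι_bracket p q))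

theorem ι_sq (z : S.sumGrading 1) : S.ι z * S.ι z = S.ι (S.sumSq z) := by
  change S.mkU (S.barι z) * S.mkU (S.barι z) = S.mkU (S.barι (S.sumSq z))
  rw [← map_mul]
  exact congrArg S.mkU (Subtype.ext (S.directSum.envι_sq z))

variable {S} in
/-- Induction over sums, multiples and products of the generators `ι p`; no case for `1` is needed,
since `Ū(A ⊕ L)` is generated as a non-unital algebra. -/
theorem U_induction {p : S.U → Prop} (zero : p 0) (ι : ∀ x, p (S.ι x))
    (add : ∀ u v, p u → p v → p (u + v)) (smul : ∀ (k : K) u, p u → p (k • u))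
    (mul : ∀ u v, p u → p v → p (u * v)) (u : S.U) : p u := by
  obtain ⟨⟨x, hx⟩, rfl⟩ := S.mkU_surjective u
  induction hx using NonUnitalAlgebra.adjoin_induction with
  | mem x hx => obtain ⟨y, rfl⟩ := hx; exact ι y
  | zero => exact zero
  | add x y hx hy hpx hpy => exact add _ _ hpx hpy
  | mul x y hx hy hpx hpy => exact mul _ _ hpx hpy
  | smul k x hx hpx => exact smul k _ hpx

/-- Linear maps `φ : A ⊕ L → B` into a not necessarily unital algebra that satisfy the relations
defining `U(A, L, ρ)`. -/
structure IsEnvMap {B : Type*} [NonUnitalRing B] [Module K B] (φ : A × L →ₗ[K] B) : Prop where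
  bracket : ∀ p q, φ p * φ q + φ q * φ p = φ (S.sumBracket p q)
  sq : ∀ z : S.sumGrading 1, φ z * φ z = φ (S.sumSq z)
  mul : ∀ (a b : A) (x : L), φ (a, 0) * φ (b, x) = φ (a * b, a • x)

variable {S}

theorem algHom_ext {B : Type*} [NonUnitalRing B] [Module K B] {f g : S.U →ₙₐ[K] B}
    (h : ∀ p, f (S.ι p) = g (S.ι p)) : f = g := by
  ext u
  induction u using U_induction with
  | zero => rw [map_zero, map_zero]
  | ι p => exact h p
  | add u v hu hv => rw [map_add, map_add, hu, hv]
  | smul k u hu => rw [map_smul, map_smul, hu]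
  | mul u v hu hv => rw [map_mul, map_mul, hu, hv]

section lift
variable {B : Type*} [NonUnitalRing B] [Module K B] [IsScalarTower K B B] [SMulCommClass K B B]

/-- The non-unital target is replaced by its unitization, to which the unital enveloping algebra
of `A ⊕ L` maps; the subalgebra generated by `A ⊕ L` maps into the augmentation ideal `B`. -/
theorem exists_barLift {φ : A × L →ₗ[K] B} (hφ : S.IsEnvMap φ) :
    ∃ g : S.envBar →ₙₐ[K] B, ∀ p, g (S.barι p) = φ p := by
  obtain ⟨F, hF⟩ := S.directSum.exists_envLift (Unitization.inrHom K K B ∘ₗ φ)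
    (fun p q => by
      change (φ p : Unitization K B) * φ q + φ q * φ p = (φ (S.sumBracket p q) : Unitization K B)
      rw [← hφ.bracket, Unitization.inr_add, Unitization.inr_mul, Unitization.inr_mul])
    (fun z => by
      change (φ z : Unitization K B) * φ z = (φ (S.sumSq z) : Unitization K B)
      rw [← hφ.sq, Unitization.inr_mul])
  have hfst : ∀ x : S.envBar, F x = ((F x).snd : Unitization K B) := by
    rintro ⟨x, hx⟩
    suffices h : (F x).fst = 0 by
      ext
      · rw [Unitization.fst_inr]; exact h
      · rw [Unitization.snd_inr]
    induction hx using NonUnitalAlgebra.adjoin_induction with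
    | mem x hx => obtain ⟨y, rfl⟩ := hx; rw [hF]; rfl
    | zero => rw [map_zero]; rfl
    | add x y _ _ hx hy => rw [map_add, Unitization.fst_add, hx, hy, add_zero]
    | mul x y _ _ hx hy => rw [map_mul, Unitization.fst_mul, hx, zero_mul]
    | smul k x _ hx => rw [map_smul, Unitization.fst_smul, hx, smul_zero]
  refine ⟨{ toFun := fun x => (F x).snd
            map_smul' := ?_
            map_zero' := ?_
            map_add' := ?_
            map_mul' := ?_ }, fun p => ?_⟩
  · intro k x
    change (F (k • (x : S.directSum.Env))).snd = _
    rw [map_smul, Unitization.snd_smul]; rfl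
  · change (F 0).snd = 0
    rw [map_zero]; rfl
  · intro x y
    change (F ((x : S.directSum.Env) + y)).snd = _
    rw [map_add, Unitization.snd_add]
  · intro x y
    change (F ((x : S.directSum.Env) * y)).snd = _
    rw [map_mul, hfst x, hfst y, ← Unitization.inr_mul]; rfl
  · change (F (S.directSum.envι p)).snd = φ p
    rw [hF]; rfl

/-- The existence part of the universal property of `U(A, L, ρ)`, for maps into algebras that need
not be unital; uniqueness is `algHom_ext`. -/
theorem exists_lift {φ : A × L →ₗ[K] B} (hφ : S.IsEnvMap φ) :
    ∃ f : S.U →ₙₐ[K] B, ∀ p, f (S.ι p) = φ p := by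
  obtain ⟨g, hg⟩ := exists_barLift hφ
  have hker : ∀ x ∈ S.envIdeal, g x = 0 := by
    intro x hx
    induction hx using TwoSidedIdeal.span_induction with
    | mem u hu =>
      obtain ⟨a, b, x, rfl⟩ := hu
      rw [map_add, map_mul, hg, hg, hg, hφ.mul, add_self_eq_zero_of_charTwo K]
    | zero => exact map_zero g
    | add x y _ _ hx hy => rw [map_add, hx, hy, add_zero]
    | neg x _ hx => rw [map_neg, hx, neg_zero]
    | left_absorb a x _ hx => rw [map_mul, hx, mul_zero]
    | right_absorb a x _ hx => rw [map_mul, hx, zero_mul]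
  have hwd : ∀ x y, S.mkU x = S.mkU y → g x = g y := fun x y hxy => by
    rw [← sub_eq_zero, ← map_sub]
    exact hker _ ((IdealQuotient.mk_eq _).1 hxy)
  -- The induced map on the quotient is computed on arbitrary representatives `σ u`.
  let σ : S.U → S.envBar := Function.surjInv S.mkU_surjective
  have hσ : ∀ u, S.mkU (σ u) = u := Function.surjInv_eq S.mkU_surjective
  refine ⟨{ toFun := fun u => g (σ u)
            map_smul' := ?_
            map_zero' := ?_
            map_add' := ?_
            map_mul' := ?_ }, fun p => ?_⟩
  · intro k u
    rw [MonoidHom.id_apply, ← map_smul]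
    exact hwd _ _ (by rw [hσ, mkU_smul, hσ])
  · rw [← map_zero g]
    exact hwd _ _ (by rw [hσ, map_zero])
  · intro u v
    rw [← map_add]
    exact hwd _ _ (by rw [hσ, map_add, hσ, hσ])
  · intro u v
    rw [← map_mul]
    exact hwd _ _ (by rw [hσ, map_mul, hσ, hσ])
  · change g (σ (S.ι p)) = φ p
    rw [← hg]
    exact hwd _ _ (hσ _)

end lift

variable (S)

/-! ### The grading of `U(A, L, ρ)` -/

theorem ι_mem {k : ZMod 2} {p : A × L} (hp : p ∈ S.sumGrading k) : S.ι p ∈ S.grading k :=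
  Submodule.subset_span (.ι k p hp)

theorem mul_mem_grading {i j k : ZMod 2} (h : i + j = k) {u v : S.U} (hu : u ∈ S.grading i)
    (hv : v ∈ S.grading j) : u * v ∈ S.grading k := by
  subst h
  induction hu using Submodule.span_induction with
  | zero => rw [zero_mul]; exact zero_mem _
  | add u w _ _ hu hw => rw [add_mul]; exact add_mem hu hw
  | smul k u _ hu => rw [smul_mul_assoc]; exact Submodule.smul_mem _ _ hu
  | mem u hu =>
    induction hv using Submodule.span_induction with
    | zero => rw [mul_zero]; exact zero_mem _
    | add v w _ _ hv hw => rw [mul_add]; exact add_mem hv hw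
    | smul k v _ hv => rw [mul_smul_comm]; exact Submodule.smul_mem _ _ hv
    | mem v hv => exact Submodule.subset_span (.mul i j u v hu hv)

theorem grading_sup_eq_top : S.grading 0 ⊔ S.grading 1 = ⊤ := by
  rw [eq_top_iff]
  rintro u -
  induction u using U_induction with
  | zero => exact zero_mem _
  | ι p =>
    obtain ⟨a, b, rfl⟩ := S.directSum.exists_parts p
    rw [map_add]
    exact Submodule.add_mem_sup (S.ι_mem a.2) (S.ι_mem b.2)
  | add u v hu hv => exact add_mem hu hv
  | smul k u hu => exact Submodule.smul_mem _ _ hu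
  | mul u v hu hv =>
    obtain ⟨u0, hu0, u1, hu1, rfl⟩ := Submodule.mem_sup.1 hu
    obtain ⟨v0, hv0, v1, hv1, rfl⟩ := Submodule.mem_sup.1 hv
    rw [show (u0 + u1) * (v0 + v1) = (u0 * v0 + u1 * v1) + (u0 * v1 + u1 * v0) by noncomm_ring]
    exact Submodule.add_mem_sup
      (add_mem (S.mul_mem_grading (by decide) hu0 hv0) (S.mul_mem_grading (by decide) hu1 hv1))
      (add_mem (S.mul_mem_grading (by decide) hu0 hv1) (S.mul_mem_grading (by decide) hu1 hv0))

variable {S} in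
/-- A morphism of algebras on `U(A, L, ρ)` is even if it is even on `A ⊕ L`. -/
theorem map_mem_of_ι {B : Type*} [NonUnitalRing B] [Module K B] {ℬ : ZMod 2 → Submodule K B}
    (hℬ : ∀ (i j : ZMod 2), ∀ a ∈ ℬ i, ∀ b ∈ ℬ j, a * b ∈ ℬ (i + j)) (f : S.U →ₙₐ[K] B)
    (h : ∀ k, ∀ p ∈ S.sumGrading k, f (S.ι p) ∈ ℬ k) {k : ZMod 2} {u : S.U}
    (hu : u ∈ S.grading k) : f u ∈ ℬ k := by
  induction hu using Submodule.span_induction with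
  | zero => rw [map_zero]; exact zero_mem _
  | add u v _ _ hu hv => rw [map_add]; exact add_mem hu hv
  | smul k u _ hu => rw [map_smul]; exact Submodule.smul_mem _ _ hu
  | mem u hu =>
    induction hu with
    | ι k p hp => exact h k p hp
    | mul i j u v _ _ hu hv => rw [map_mul]; exact hℬ _ _ _ hu _ hv

/-- The `ℤ/2 × ℤ/2` matrix over `U` with the entry `u` in the places `(i, i + k)` and `0` elsewhere,
which represents the element `u ⊗ e_k` of `U ⊗ K[ℤ/2]`. -/
def degreeMatrix (k : ZMod 2) : S.U →ₗ[K] Matrix (ZMod 2) (ZMod 2) S.U where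
  toFun u := Matrix.of fun i j => if j = i + k then u else 0
  map_add' u v := by ext i j; simp only [Matrix.of_apply, Matrix.add_apply]; split_ifs <;> simp
  map_smul' c u := by ext i j; simp only [Matrix.of_apply, Matrix.smul_apply]; split_ifs <;> simp

theorem degreeMatrix_apply (k : ZMod 2) (u : S.U) (i j : ZMod 2) :
    S.degreeMatrix k u i j = if j = i + k then u else 0 := rfl

theorem degreeMatrix_mul (k l : ZMod 2) (u v : S.U) :
    S.degreeMatrix k u * S.degreeMatrix l v = S.degreeMatrix (k + l) (u * v) := by
  ext i j
  rw [Matrix.mul_apply, Finset.sum_eq_single (i + k)]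
  · simp only [degreeMatrix_apply, if_true, mul_ite, mul_zero, add_assoc]
  · intro r _ hr
    rw [degreeMatrix_apply, if_neg hr, zero_mul]
  · intro h
    exact absurd (Finset.mem_univ _) h

theorem isCompl_sumGrading : IsCompl (S.sumGrading 0) (S.sumGrading 1) :=
  (isInternal_iff_isCompl _).1 S.directSum.isInternal

/-- The map `A ⊕ L → U ⊗ K[ℤ/2]` with `p ↦ p ⊗ e_k` for `p` of degree `k`. -/
def coactionι : A × L →ₗ[K] Matrix (ZMod 2) (ZMod 2) S.U :=
  LinearMap.ofIsCompl S.isCompl_sumGrading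
    (S.degreeMatrix 0 ∘ₗ S.ι ∘ₗ (S.sumGrading 0).subtype)
    (S.degreeMatrix 1 ∘ₗ S.ι ∘ₗ (S.sumGrading 1).subtype)

theorem coactionι_of_mem {k : ZMod 2} {p : A × L} (hp : p ∈ S.sumGrading k) :
    S.coactionι p = S.degreeMatrix k (S.ι p) := by
  rcases parity_cases k with rfl | rfl
  · exact LinearMap.ofIsCompl_apply_left S.isCompl_sumGrading ⟨p, hp⟩
  · exact LinearMap.ofIsCompl_apply_right S.isCompl_sumGrading ⟨p, hp⟩

theorem isEnvMap_coactionι : S.IsEnvMap S.coactionι where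
  bracket p q := by
    have hom : ∀ {i j : ZMod 2} {p q : A × L}, p ∈ S.sumGrading i → q ∈ S.sumGrading j →
        S.coactionι p * S.coactionι q + S.coactionι q * S.coactionι p =
          S.coactionι (S.sumBracket p q) := by
      intro i j p q hp hq
      have hpq : S.sumBracket p q ∈ S.sumGrading (i + j) := S.directSum.bracket_mem i j p hp q hq
      rw [S.coactionι_of_mem hp, S.coactionι_of_mem hq, degreeMatrix_mul, degreeMatrix_mul,
        S.coactionι_of_mem hpq, add_comm j i, ← map_add,
        ι_bracket]
    obtain ⟨a, b, rfl⟩ := S.directSum.exists_parts p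
    obtain ⟨c, d, rfl⟩ := S.directSum.exists_parts q
    simp only [map_add, LinearMap.add_apply, ← hom a.2 c.2, ← hom a.2 d.2, ← hom b.2 c.2,
      ← hom b.2 d.2,
      add_mul, mul_add]
    abel
  sq z := by
    rw [S.coactionι_of_mem z.2, S.coactionι_of_mem (S.sumSq z).2, degreeMatrix_mul, ι_sq]
    rfl
  mul a b x := by
    have hom : ∀ {i j : ZMod 2} {a : A} {q : A × L}, a ∈ 𝒜 i → q ∈ S.sumGrading j →
        S.coactionι (a, 0) * S.coactionι q = S.coactionι (a * q.1, a • q.2) := by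
      intro i j a q ha hq
      have ha' : ((a, 0) : A × L) ∈ S.sumGrading i := ⟨ha, zero_mem _⟩
      have haq : ((a * q.1, a • q.2) : A × L) ∈ S.sumGrading (i + j) :=
        ⟨SetLike.GradedMul.mul_mem ha hq.1, S.smul_mem i j a ha q.2 hq.2⟩
      rw [S.coactionι_of_mem ha', S.coactionι_of_mem hq, degreeMatrix_mul,
        S.coactionι_of_mem haq, ← ι_mul]
    have add_left : ∀ (a a' : A) (q : A × L), (((a + a') * q.1, (a + a') • q.2) : A × L) =
        (a * q.1, a • q.2) + (a' * q.1, a' • q.2) := fun a a' q =>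
      Prod.ext (add_mul _ _ _) (add_smul _ _ _)
    have add_right : ∀ (a : A) (q q' : A × L), ((a * (q + q').1, a • (q + q').2) : A × L) =
        (a * q.1, a • q.2) + (a * q'.1, a • q'.2) := fun a q q' =>
      Prod.ext (mul_add _ _ _) (smul_add _ _ _)
    change _ * S.coactionι (b, x) = S.coactionι (a * (b, x).1, a • (b, x).2)
    generalize ((b, x) : A × L) = q
    obtain ⟨c, d, rfl⟩ := S.directSum.exists_parts q
    obtain ⟨a0, a1, m0, m1, rfl⟩ : ∃ a0 a1, a0 ∈ 𝒜 0 ∧ a1 ∈ 𝒜 1 ∧ a = a0 + a1 :=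
      ⟨_, _, PoissonSuperalgebra.proj_mem (K := K) (𝒜 := 𝒜) 0 a,
        PoissonSuperalgebra.proj_mem (K := K) (𝒜 := 𝒜) 1 a,
        (PoissonSuperalgebra.proj_add_proj (K := K) (𝒜 := 𝒜) a).symm⟩
    have ea : ((a0 + a1, 0) : A × L) = (a0, 0) + (a1, 0) := by rw [Prod.mk_add_mk, add_zero]
    rw [ea, add_right, add_left, add_left]
    simp only [map_add, ← hom m0 c.2, ← hom m0 d.2, ← hom m1 c.2, ← hom m1 d.2,
      add_mul, mul_add]

/-- The pieces of `U(A, L, ρ)` meet in `0` because the algebra map `U → U ⊗ K[ℤ/2]` that extends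
`p ↦ p ⊗ e_k` sends `u` of degree `k` to `u ⊗ e_k`. -/
theorem isInternal_grading : DirectSum.IsInternal S.grading := by
  obtain ⟨f, hf⟩ := exists_lift S.isEnvMap_coactionι
  have key : ∀ k, ∀ u ∈ S.grading k, f u = S.degreeMatrix k u := by
    intro k u hu
    induction hu using Submodule.span_induction with
    | zero => rw [map_zero, map_zero]
    | add u v _ _ hu hv => rw [map_add, map_add, hu, hv]
    | smul c u _ hu => rw [map_smul, map_smul, hu]
    | mem u hu =>
      induction hu with
      | ι k p hp => rw [hf, S.coactionι_of_mem hp]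
      | mul i j u v _ _ hu hv => rw [map_mul, hu, hv, degreeMatrix_mul]
  rw [isInternal_iff_isCompl]
  refine ⟨Submodule.disjoint_def.2 fun u h0 h1 => ?_, codisjoint_iff.2 S.grading_sup_eq_top⟩
  -- At the place `(0, 0)` the matrix of degree `0` has the entry `u`, that of degree `1` has `0`.
  have h := congrFun (congrFun ((key 0 u h0).symm.trans (key 1 u h1)) 0) 0
  simpa [degreeMatrix_apply] using h

theorem isAssocSuperalgebra_U : IsAssocSuperalgebra S.grading :=
  ⟨S.isInternal_grading, fun _ _ _ hu _ hv => S.mul_mem_grading rfl hu hv⟩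

/-! ### The identity of `U(A, L, ρ)` -/

/-- That `ι_A(1)` is a left identity on `A ⊕ L` is among the defining relations; it commutes with
`A ⊕ L` because derivations vanish at `1`. -/
theorem ιA_one_mul_and_mul_ιA_one (u : S.U) : S.ιA 1 * u = u ∧ u * S.ιA 1 = u := by
  have h1 : ∀ p, S.ιA 1 * S.ι p = S.ι p := fun p => by
    have := S.ι_mul 1 p.1 p.2
    rwa [one_mul, one_smul] at this
  have h2 : ∀ p, S.ι p * S.ιA 1 = S.ι p := fun p => by
    have h := S.ι_bracket (1, 0) p
    rw [sumBracket_apply, map_zero, map_zero, Derivation.map_one_eq_zero] at h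
    have h' : S.ιA 1 * S.ι p + S.ι p * S.ιA 1 = 0 :=
      h.trans (by simp [Prod.mk_zero_zero])
    rw [h1, ← sub_eq_add_of_charTwo K] at h'
    exact (sub_eq_zero.1 h').symm
  induction u using U_induction with
  | zero => simp
  | ι p => exact ⟨h1 p, h2 p⟩
  | add u v hu hv => rw [mul_add, add_mul, hu.1, hu.2, hv.1, hv.2]; exact ⟨rfl, rfl⟩
  | smul k u hu => rw [mul_smul_comm, smul_mul_assoc, hu.1, hu.2]; exact ⟨rfl, rfl⟩
  | mul u v hu hv => rw [← mul_assoc, mul_assoc u, hu.1, hv.2]; exact ⟨rfl, rfl⟩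

end LieRinehartSuperalgebra
/-! ### Extension of `h` to differentials -/

section UnitalPart
variable {K P B : Type*} [Field K] [CommRing P] [Algebra K P]
  [NonUnitalRing B] [Module K B] [IsScalarTower K B B] [SMulCommClass K B B]

/-- The part `m(1) B` of `B`, on which `m(1)` acts as the identity from the left. -/
def unitalPart (m : P →ₙₐ[K] B) : Submodule K B where
  carrier := {b | m 1 * b = b}
  add_mem' {a b} ha hb := by
    change m 1 * (a + b) = a + b
    rw [mul_add, ha, hb]
  zero_mem' := mul_zero _
  smul_mem' k b hb := by
    change m 1 * (k • b) = k • b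
    rw [mul_smul_comm, hb]

theorem mul_mem_unitalPart (m : P →ₙₐ[K] B) (a : P) (b : B) : m a * b ∈ unitalPart m := by
  change m 1 * (m a * b) = m a * b
  rw [← mul_assoc, ← map_mul, one_mul]

/-- The unital `P`-module structure on `m(1) B` in which `P` acts by left multiplication
through `m`. -/
abbrev unitalPartModule (m : P →ₙₐ[K] B) : Module P (unitalPart m) where
  smul a b := ⟨m a * b, mul_mem_unitalPart m a b⟩
  one_smul b := Subtype.ext b.2
  mul_smul a a' b := Subtype.ext (by
    change m (a * a') * (b : B) = m a * (m a' * b)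
    rw [map_mul, mul_assoc])
  smul_zero a := Subtype.ext (mul_zero (m a))
  smul_add a b b' := Subtype.ext (mul_add (m a) (b : B) b')
  add_smul a a' b := Subtype.ext (by
    change m (a + a') * (b : B) = m a * b + m a' * b
    rw [map_add, add_mul])
  zero_smul b := Subtype.ext (by
    change m 0 * (b : B) = 0
    rw [map_zero, zero_mul])

/-- A linear map `h` with `h(xy) = m(x) h(y) + m(y) h(x)` takes values in `m(1) B`, so that it is a
derivation into a unital `P`-module and factors through the differentials. -/
theorem exists_kaehlerLift (m : P →ₙₐ[K] B) (h : P →ₗ[K] B)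
    (hmul : ∀ x y, h (x * y) = m x * h y + m y * h x) :
    ∃ H : Ω[P⁄K] →ₗ[K] B, (∀ y, H (KaehlerDifferential.D K P y) = h y) ∧
      ∀ (x : P) (ω : Ω[P⁄K]), H (x • ω) = m x * H ω := by
  let := unitalPartModule m
  have : IsScalarTower K P (unitalPart m) := ⟨fun k a b => Subtype.ext (by
    change m (k • a) * (b : B) = k • (m a * (b : B))
    rw [map_smul, smul_mul_assoc])⟩
  -- `h(1) = 2 m(1) h(1)`; multiplication by the idempotent `m(1)` gives `m(1) h(1) = 0`.
  have h1 : h 1 = 0 := by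
    have e1 := hmul 1 1
    have e2 : m 1 * h 1 = m 1 * h 1 + m 1 * h 1 := by
      have := congrArg (m 1 * ·) e1
      simpa only [mul_add, ← mul_assoc, ← map_mul, mul_one] using this
    rw [mul_one, left_eq_add.1 e2, add_zero] at e1
    exact e1
  have hmem : ∀ x, h x ∈ unitalPart m := fun x => by
    have e := hmul 1 x
    rw [h1, mul_zero, add_zero, one_mul] at e
    exact e.symm
  let D : Derivation K P (unitalPart m) := Derivation.mk' (h.codRestrict _ hmem)
    (fun a b => Subtype.ext (hmul a b))
  refine ⟨(unitalPart m).subtype ∘ₗ D.liftKaehlerDifferential.restrictScalars K,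
    fun y => ?_, fun x ω => ?_⟩
  · change ((D.liftKaehlerDifferential (KaehlerDifferential.D K P y) : unitalPart m) : B) = h y
    rw [Derivation.liftKaehlerDifferential_comp_D]
    rfl
  · change ((D.liftKaehlerDifferential (x • ω) : unitalPart m) : B) = _
    rw [map_smul]
    rfl

end UnitalPart

namespace PoissonSuperalgebra
variable {K P : Type*} [Field K] [CharP K 2] [CommRing P] [Algebra K P]
  {𝒜 : ZMod 2 → Submodule K P} [GradedAlgebra 𝒜] {S : PoissonSuperalgebra K P 𝒜}

/-! ### Enveloping triples give maps that satisfy the relations of `U(P, Ω_P)` -/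

section triple
variable {B : Type*} [NonUnitalRing B] [Module K B] {ℬ : ZMod 2 → Submodule K B}
  {m : P →ₙₐ[K] B} {h : P →ₗ[K] B}

/-- The compatibility of `h` with brackets for all parities; on two odd elements it is the
polarization of the compatibility with squarings. -/
theorem IsEnvelopingTriple.map_bracket (T : S.IsEnvelopingTriple ℬ m h) (x y : P) :
    h x * h y + h y * h x = h (S.bracket x y) := by
  have he : ∀ (x : 𝒜 0) (y : P), h (S.bracket x y) = h x * h y + h y * h x := fun x y => by
    rw [T.h_bracket x x.2, sub_eq_add_of_charTwo K]
  have ho : ∀ x y : 𝒜 1, h (S.bracket x y) = h x * h y + h y * h x := fun x y => by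
    rw [S.bracket_odd, map_sub, map_sub, T.h_sq, T.h_sq, T.h_sq, Submodule.coe_add, map_add]
    noncomm_ring
  obtain ⟨a, b, rfl⟩ := S.exists_parts x
  obtain ⟨c, d, rfl⟩ := S.exists_parts y
  have hbc := he c b
  rw [S.comm] at hbc
  simp only [map_add, LinearMap.add_apply, he a, ho, hbc, mul_add, add_mul]
  abel

/-- The symmetric form of `uea2`, since the bracket is symmetric in characteristic `2`. -/
theorem IsEnvelopingTriple.mul_comm_add (T : S.IsEnvelopingTriple ℬ m h) (x y : P) :
    h x * m y = m y * h x + m (S.bracket x y) := by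
  rw [S.comm, T.uea2, ← add_assoc, add_self_eq_zero_of_charTwo K, zero_add]

variable {H : Ω[P⁄K] →ₗ[K] B}

/-- The commutation rule `H(ω) m(b) + m(b) H(ω) = m(ρ_ω(b))`. -/
theorem IsEnvelopingTriple.lift_mul_comm_add (T : S.IsEnvelopingTriple ℬ m h)
    (hD : ∀ y, H (KaehlerDifferential.D K P y) = h y) (hs : ∀ (x : P) ω, H (x • ω) = m x * H ω)
    (ω : Ω[P⁄K]) (b : P) : H ω * m b = m b * H ω + m (S.kaehlerAnchor ω b) := by
  induction ω using kaehler_induction with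
  | zero => simp
  | add x y hx hy =>
    rw [map_add, add_mul, hx, hy, map_add, Derivation.add_apply, map_add, mul_add]; abel
  | D y => rw [hD, kaehlerAnchor_D, ham_apply, T.mul_comm_add]
  | smul x ω hω =>
    rw [hs, mul_assoc, hω, mul_add, map_smul, Derivation.smul_apply, smul_eq_mul, map_mul,
      ← mul_assoc, ← mul_assoc, ← map_mul, ← map_mul, ← map_mul, mul_comm]

/-- The extension `H` of `h` to differentials preserves brackets. Both sides change in the same way
when an argument is multiplied by an element of `P`, so it suffices to consider `dx` and `dy`. -/
theorem IsEnvelopingTriple.lift_bracket (T : S.IsEnvelopingTriple ℬ m h)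
    (hD : ∀ y, H (KaehlerDifferential.D K P y) = h y) (hs : ∀ (x : P) ω, H (x • ω) = m x * H ω)
    (ω η : Ω[P⁄K]) : H ω * H η + H η * H ω = H (S.kaehlerBracket ω η) := by
  have hc := T.lift_mul_comm_add hD hs
  have hsmul : ∀ (x : P) (ω η : Ω[P⁄K]), H ω * H η + H η * H ω = H (S.kaehlerBracket ω η) →
      H ω * H (x • η) + H (x • η) * H ω = H (S.kaehlerBracket ω (x • η)) := fun x ω η e => by
    rw [kaehlerBracket_smul, map_add, hs, hs, hs, ← e, ← mul_assoc, hc]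
    simp only [mul_add, add_mul, mul_assoc]
    abel
  induction ω using kaehler_induction with
  | zero => simp
  | add x y hx hy =>
    rw [map_add, map_add, LinearMap.add_apply, map_add, ← hx, ← hy, add_mul, mul_add]; abel
  | smul x ω hω =>
    rw [add_comm, S.kaehlerBracket_comm]
    refine hsmul x η ω ?_
    rw [add_comm, S.kaehlerBracket_comm, hω]
  | D a =>
    induction η using kaehler_induction with
    | zero => simp
    | add x y hx hy =>
      rw [map_add, map_add, map_add, ← hx, ← hy, add_mul, mul_add]; abel
    | smul x η hη => exact hsmul x _ η hη
    | D b => rw [hD, hD, kaehlerBracket_D_D, hD, T.map_bracket]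

/-- The extension `H` of `h` to differentials preserves squarings (the component `q` of `S.sqLift ω` is
the squaring of an odd `ω`). -/
theorem IsEnvelopingTriple.lift_sq [IsScalarTower K B B] [SMulCommClass K B B]
    (T : S.IsEnvelopingTriple ℬ m h)
    (hD : ∀ y, H (KaehlerDifferential.D K P y) = h y) (hs : ∀ (x : P) ω, H (x • ω) = m x * H ω)
    {ω : Ω[P⁄K]} (hω : ω ∈ kaehlerGrading 𝒜 1) : H ω * H ω = H (S.sqLift ω).q := by
  induction hω using Submodule.span_induction with
  | zero => simp
  | add x y hx' hy' hx hy =>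
    rw [map_add, map_add, SqTwist.add_q, (S.sqLift_odd hx').2.1, (S.sqLift_odd hy').2.1, map_add,
      map_add, ← hx, ← hy, ← T.lift_bracket hD hs, mul_add, add_mul, add_mul]
    abel
  | smul k x _ hx =>
    rw [sqLift_ksmul, map_smul, map_smul, ← hx, smul_mul_smul_comm, pow_two]
  | mem x hx =>
    obtain ⟨i, j, hij, a, ha, b, hb, rfl⟩ := hx
    have e : H (a • KaehlerDifferential.D K P b) * H (a • KaehlerDifferential.D K P b) =
        m (a * a) * (h b * h b) + m (a * S.bracket b a) * h b := by
      rw [hs, hD, mul_assoc, ← mul_assoc (h b), T.mul_comm_add, map_mul, map_mul]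
      simp only [mul_add, add_mul, mul_assoc]
    rw [e, map_smul]
    rcases parity_cases i with rfl | rfl
    · obtain rfl : j = 1 := by simpa using hij
      rw [sqLift_D_odd S hb, smul_even S ha]
      simp only [map_add, hs, hD, kaehlerAnchor_D, ham_apply, pow_two]
      rw [T.h_sq ⟨b, hb⟩]
    · obtain rfl := eq_zero_of_one_add hij
      rw [sqLift_D_even S hb, smul_odd S ha, S.odd_mul_self a ha]
      simp only [map_zero, zero_mul, zero_add, hs, hD, kaehlerAnchor_D, ham_apply]

/-- The extension `H` of `h` to differentials is even. -/
theorem IsEnvelopingTriple.lift_mem (T : S.IsEnvelopingTriple ℬ m h)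
    (hD : ∀ y, H (KaehlerDifferential.D K P y) = h y) (hs : ∀ (x : P) ω, H (x • ω) = m x * H ω)
    {k : ZMod 2} {ω : Ω[P⁄K]} (hω : ω ∈ kaehlerGrading 𝒜 k) : H ω ∈ ℬ k := by
  induction hω using Submodule.span_induction with
  | zero => rw [map_zero]; exact zero_mem _
  | add x y _ _ hx hy => rw [map_add]; exact add_mem hx hy
  | smul k x _ hx => rw [map_smul]; exact Submodule.smul_mem _ _ hx
  | mem x hx =>
    obtain ⟨i, j, rfl, a, ha, b, hb, rfl⟩ := hx
    rw [hs, hD]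
    exact T.superalgebra.mul_mem i j _ (T.m_mem i a ha) _ (T.h_mem j b hb)

/-- The map `a + ω ↦ m(a) + H(ω)` satisfies the defining relations of `U(P, Ω_P)`. -/
theorem IsEnvelopingTriple.isEnvMap [IsScalarTower K B B] [SMulCommClass K B B]
    (T : S.IsEnvelopingTriple ℬ m h)
    (hD : ∀ y, H (KaehlerDifferential.D K P y) = h y) (hs : ∀ (x : P) ω, H (x • ω) = m x * H ω) :
    S.kaehlerLieRinehart.IsEnvMap ((m : P →ₗ[K] B).coprod H) where
  bracket p q := by
    change (m p.1 + H p.2) * (m q.1 + H q.2) + (m q.1 + H q.2) * (m p.1 + H p.2) =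
      m (S.kaehlerAnchor p.2 q.1 + S.kaehlerAnchor q.2 p.1) + H (S.kaehlerBracket p.2 q.2)
    have hc := T.lift_mul_comm_add hD hs
    have h1 : m p.1 * m q.1 + m q.1 * m p.1 = 0 := by
      rw [← map_mul, ← map_mul, mul_comm, add_self_eq_zero_of_charTwo K]
    have h2 := add_self_eq_zero_of_charTwo K (m p.1 * H q.2)
    have h3 := add_self_eq_zero_of_charTwo K (m q.1 * H p.2)
    calc _ = (m p.1 * m q.1 + m q.1 * m p.1) + (m p.1 * H q.2 + m p.1 * H q.2) +
          (m q.1 * H p.2 + m q.1 * H p.2) + (m (S.kaehlerAnchor p.2 q.1) +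
            m (S.kaehlerAnchor q.2 p.1) + (H p.2 * H q.2 + H q.2 * H p.2)) := by
          simp only [mul_add, add_mul, hc]; abel
      _ = _ := by rw [h1, h2, h3, T.lift_bracket hD hs, map_add]; abel
  sq z := by
    change (m z.1.1 + H z.1.2) * (m z.1.1 + H z.1.2) =
      m (S.kaehlerAnchor z.1.2 z.1.1) + H (S.sqLift z.1.2).q
    have h1 : m z.1.1 * m z.1.1 = 0 := by
      rw [← map_mul, S.odd_mul_self _ z.2.1, map_zero]
    have h2 := add_self_eq_zero_of_charTwo K (m z.1.1 * H z.1.2)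
    rw [← T.lift_sq hD hs z.2.2, mul_add, add_mul, add_mul, T.lift_mul_comm_add hD hs, h1,
      zero_add, ← add_assoc, add_right_comm (m z.1.1 * H z.1.2), h2]
    abel
  mul a b x := by
    change (m a + H 0) * (m b + H x) = m (a * b) + H (a • x)
    rw [map_zero, add_zero, mul_add, map_mul, hs]

end triple

/-! ### The enveloping triple of `U(P, Ω_P)` -/

variable (S) in
theorem isEnvelopingTriple_U : S.IsEnvelopingTriple S.kaehlerLieRinehart.grading
    S.kaehlerLieRinehart.ιA
    (S.kaehlerLieRinehart.ιL ∘ₗ (KaehlerDifferential.D K P : P →ₗ[K] Ω[P⁄K])) := by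
  set R := S.kaehlerLieRinehart
  have hm : ∀ x, R.ιA x = R.ι (x, 0) := fun _ => rfl
  have hh : ∀ x, (R.ιL ∘ₗ (KaehlerDifferential.D K P : P →ₗ[K] Ω[P⁄K])) x =
      R.ι (0, KaehlerDifferential.D K P x) := fun _ => rfl
  have hb : ∀ p q, R.sumBracket p q = (S.kaehlerAnchor p.2 q.1 + S.kaehlerAnchor q.2 p.1,
      S.kaehlerBracket p.2 q.2) := fun _ _ => rfl
  have u2 : ∀ x y : P, R.ι (S.bracket x y, 0) = R.ι (x, 0) * R.ι (0, KaehlerDifferential.D K P y) +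
      R.ι (0, KaehlerDifferential.D K P y) * R.ι (x, 0) := fun x y => by
    rw [R.ι_bracket, hb, S.comm]
    simp
  -- `{x, x} = 0` for all `x`, so `i_P(x)` and `i_Ω(dx)` commute; this is what gives the last two
  -- conditions.
  have u3 : ∀ x : P, R.ι (0, KaehlerDifferential.D K P x) * R.ι (x, 0) =
      R.ι (x, 0) * R.ι (0, KaehlerDifferential.D K P x) := fun x => by
    have h := u2 x x
    rw [S.alt, Prod.mk_zero_zero, map_zero, ← sub_eq_add_of_charTwo K] at h
    exact (sub_eq_zero.1 h.symm).symm
  have mm : ∀ x y : P, R.ι (x, 0) * R.ι (y, 0) = R.ι (y, 0) * R.ι (x, 0) := fun x y => by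
    rw [R.ι_mul, R.ι_mul, mul_comm, smul_zero, smul_zero]
  refine ⟨R.isAssocSuperalgebra_U, fun i x hx => R.ι_mem ⟨hx, zero_mem _⟩,
    fun i x hx => R.ι_mem ⟨zero_mem _, D_mem hx⟩, fun x _ y => ?_, fun x => ?_, fun x y => ?_,
    fun x y => ?_, fun x _ y _ => ?_, fun x _ y _ => ?_⟩
  · rw [hh, hh, hh, sub_eq_add_of_charTwo K, R.ι_bracket, hb, kaehlerBracket_D_D]
    simp
  · have h := R.ι_sq ⟨(0, KaehlerDifferential.D K P (x : P)), zero_mem _, D_mem x.2⟩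
    rw [hh, hh]
    refine Eq.trans (congrArg R.ι ?_) h.symm
    exact Prod.ext (map_zero _).symm (S.kaehlerSq_D x).symm
  · rw [hh, hh, hh, hm, hm, R.ι_mul, R.ι_mul, ← map_add, Derivation.leibniz]
    simp
  · exact u2 x y
  · rw [hm, hm, hh, mul_assoc, u3, ← mul_assoc, mm]
  · rw [hm, hm, hh, hh]
    have e := u2 x y
    have e' := u2 y x
    rw [S.comm y x] at e'
    rw [e] at e'
    -- Both sides equal `i_P(y) i_P({x, y})`, by the two expressions of `u2` for this bracket.
    have e2 : R.ι (x, 0) * R.ι (y, 0) * R.ι (0, KaehlerDifferential.D K P y) +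
        R.ι (0, KaehlerDifferential.D K P y) * R.ι (x, 0) * R.ι (y, 0) =
        R.ι (y, 0) * R.ι (y, 0) * R.ι (0, KaehlerDifferential.D K P x) +
        R.ι (y, 0) * R.ι (0, KaehlerDifferential.D K P x) * R.ι (y, 0) := by
      rw [mm x y, mul_assoc _ (R.ι (x, 0)) (R.ι (y, 0)), mm x y, ← mul_assoc, u3, mul_assoc,
        mul_assoc, ← mul_add, e', mul_add, ← mul_assoc, ← mul_assoc]
    rw [add_assoc, e2, add_left_comm, add_self_eq_zero_of_charTwo K, add_zero]

end PoissonSuperalgebra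

end

theorem mainTheorem1 {K : Type u} [Field K] [CharP K 2] {P : Type v} [CommRing P]
    [Algebra K P] {𝒜 : ZMod 2 → Submodule K P} [GradedAlgebra 𝒜]
    (S : PoissonSuperalgebra K P 𝒜) :
    PoissonSuperalgebra.IsUniversalEnveloping.{w} S S.kaehlerLieRinehart.grading
      S.kaehlerLieRinehart.ιA
      (S.kaehlerLieRinehart.ιL ∘ₗ (KaehlerDifferential.D K P : P →ₗ[K] Ω[P⁄K])) ∧
    ∀ u : S.kaehlerLieRinehart.U, S.kaehlerLieRinehart.ιA 1 * u = u ∧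
      u * S.kaehlerLieRinehart.ιA 1 = u := by
  refine ⟨⟨S.isEnvelopingTriple_U, ?_⟩, S.kaehlerLieRinehart.ιA_one_mul_and_mul_ιA_one⟩
  intro B _ _ _ _ ℬ m h T
  obtain ⟨H, hD, hs⟩ := exists_kaehlerLift m h T.uea1
  obtain ⟨f, hf⟩ := LieRinehartSuperalgebra.exists_lift (T.isEnvMap hD hs)
  have hf' : ∀ p : P × Ω[P⁄K], f (S.kaehlerLieRinehart.ι p) = m p.1 + H p.2 := hf
  refine ⟨f, ⟨fun i u hu => ?_, fun x => ?_, fun x => ?_⟩, fun g ⟨_, hgh, hgm⟩ => ?_⟩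
  · refine LieRinehartSuperalgebra.map_mem_of_ι T.superalgebra.mul_mem f (fun k p hp => ?_) hu
    rw [hf']
    exact add_mem (T.m_mem k _ hp.1) (T.lift_mem hD hs hp.2)
  · refine (hf' (0, KaehlerDifferential.D K P x)).trans ?_
    rw [map_zero, zero_add, hD]
  · refine (hf' (x, 0)).trans ?_
    rw [map_zero, add_zero]
  · refine LieRinehartSuperalgebra.algHom_ext fun p => ?_
    have hgm' : ∀ x, g (S.kaehlerLieRinehart.ι (x, 0)) = m x := hgm
    have hgh' : ∀ ω, g (S.kaehlerLieRinehart.ι (0, ω)) = H ω := fun ω => by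
      induction ω using kaehler_induction with
      | zero => rw [Prod.mk_zero_zero, map_zero, map_zero, map_zero]
      | add x y hx hy =>
        rw [← add_zero (0 : P), ← Prod.mk_add_mk, map_add, map_add, map_add, hx, hy]
      | D b => rw [hD]; exact hgh b
      | smul a x hx =>
        have e := S.kaehlerLieRinehart.ι_mul a 0 x
        rw [mul_zero] at e
        rw [← e, map_mul, hgm', hx, hs]
    rw [hf', ← hgm' p.1, ← hgh' p.2, ← map_add, ← map_add, Prod.mk_add_mk, add_zero, zero_add]
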